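/- Let $N\ge 1$ be an integer. For $x\in\mathbb{R}^N$ and $t>0$ let $$G(x,t)=(2\pi)^{-N}\int_{\mathbb{R}^N}e^{ix\cdot\xi-t|\xi|^4}\,d\xi$$ be the fundamental solution of $\partial_t+(-\Delta)^2$, and put $[S(t)\varphi](x)=\int_{\mathbb{R}^N}G(x-y,t)\varphi(y)\,dy$. Call $\beta_1\in(0,N)$ admissible if $$\beta_1>\frac{N+1}{2}\ \text{ if } N\ge 3,\qquad \beta_1>\frac12\ \text{ if } N=2,\qquad \beta_1>\frac{7}{16}\ \text{ if } N=1,$$ and if, for every $\beta\in(0,\beta_1)$, the function $\varphi(x)=|x|^{-\beta}$ satisfies $[S(t)\varphi](x)>0$ for all $(x,t)\in\mathbb{R}^N\times(0,\infty)$. Then an admissible $\beta_1$ exists. Moreover, let $\beta_1$ be admissible, $\beta\in(0,\beta_1)$ and $1<q<N/(N-\beta)$. There is a constant $C>0$ depending only on $N$, $\beta$ and $q$ such that, for every $f\in L^q(\mathbb{R}^N)$ with $f\ge 0$ a.e., the following holds. The integral $$\psi(x)=\int_{\mathbb{R}^N}\frac{f(y)}{|x-y|^{\beta}}\,dy$$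 converges for a.e. $x$; the integral defining $[S(t)\psi](x)$ converges absolutely for all $(x,t)\in\mathbb{R}^N\times(0,\infty)$; if $f$ is not a.e. equal to $0$, then $$[S(t)\psi](x)>0\quad\text{for all }(x,t)\in\mathbb{R}^N\times(0,\infty);$$ and $$|[S(t)\psi](x)|\le C\,t^{-\frac N4\left(\frac1q+\frac{\beta}{N}-1\right)}\|f\|_{L^q(\mathbb{R}^N)}\quad\text{for all }(x,t)\in\mathbb{R}^N\times(0,\infty).$$ -/

import Mathlib

open MeasureTheory

noncomputable section

namespace BiharmonicHeat

/-- The fundamental solution of `∂ₜ + (-Δ)²` on `ℝᴺ × (0, ∞)`, that is, the inverse Fourier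
transform of `ξ ↦ (2π)^(-N/2) exp(-t|ξ|⁴)` in the unitary normalisation:
`G(x, t) = (2π)^(-N) ∫ exp(i x·ξ) exp(-t|ξ|⁴) dξ`.
The imaginary part of the integrand is odd in `ξ`, so only the cosine remains. -/
def fundSol (N : ℕ) (x : EuclideanSpace ℝ (Fin N)) (t : ℝ) : ℝ :=
  ((2 * Real.pi) ^ N)⁻¹ *
    ∫ ξ : EuclideanSpace ℝ (Fin N), Real.exp (-t * ‖ξ‖ ^ 4) * Real.cos (inner ℝ x ξ)

/-- `[S(t)φ](x) = ∫ G(x - y, t) φ(y) dy`. -/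
def semigroup (N : ℕ) (t : ℝ) (φ : EuclideanSpace ℝ (Fin N) → ℝ)
    (x : EuclideanSpace ℝ (Fin N)) : ℝ :=
  ∫ y, fundSol N (x - y) t * φ y

/-- The Riesz potential `f * |·|^(-β)`, namely `ψ(x) = ∫ f(y) / |x - y|^β dy`. -/
def rieszPotential (N : ℕ) (β : ℝ) (f : EuclideanSpace ℝ (Fin N) → ℝ)
    (x : EuclideanSpace ℝ (Fin N)) : ℝ :=
  ∫ y, f y / ‖x - y‖ ^ β

/-- The explicit number above which the threshold `β₁` lies: `(N + 1) / 2` if `N ≥ 3`,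
`1 / 2` if `N = 2`, and `7 / 16` if `N = 1`. -/
def thresholdLowerBound (N : ℕ) : ℝ :=
  if 3 ≤ N then ((N : ℝ) + 1) / 2 else if N = 2 then 1 / 2 else 7 / 16

/-- `β₁` is an admissible threshold in dimension `N`: it lies in `(0, N)`, exceeds the explicit
lower bound, and `S(t)|·|^(-β)` is positive on `ℝᴺ × (0, ∞)` for every `β ∈ (0, β₁)`. -/
def IsPositivityThreshold (N : ℕ) (β₁ : ℝ) : Prop :=
  β₁ ∈ Set.Ioo (0 : ℝ) N ∧ thresholdLowerBound N < β₁ ∧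
    ∀ β ∈ Set.Ioo (0 : ℝ) β₁, ∀ (x : EuclideanSpace ℝ (Fin N)) (t : ℝ), 0 < t →
      0 < semigroup N t (fun y => ‖y‖ ^ (-β)) x

end BiharmonicHeat

end

/-!
Write `ψ = f * |·|^(-β)`. By Fubini `S(t)ψ = f * k` with `k = S(t)|·|^(-β)`, so everything reduces
to the evolution `k` of a pure power. The kernel `G(·, t)` is the Fourier transform of a Schwartz
function, hence decays rapidly, and `|k(x)| ≤ C (1 + |x|)^(-β)`. Since `q < N / (N - β)` means
`β q' > N`, the function `k` lies in `L^{q'}`; Hölder's inequality and the scaling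
`G(Rx, R⁴) = R^(-N) G(x, 1)` give convergence and the decay estimate
(`abs_semigroup_rieszPotential_le`), and positivity of `k` passes to `S(t)ψ`
(`semigroup_rieszPotential_pos`).

It remains to find an admissible threshold. By scaling only `t = 1` matters, and writing `|·|^(-β)`
as a superposition of Gaussians shows that `S(1)|·|^(-β)` at `x` is a positive multiple of
`∫ |ξ|^(β - N) exp(-|ξ|⁴) cos(x·ξ) dξ` (`powerEvolution_one_pos_iff`). In polar coordinates this
is a radial integral of `s ^ (β - 1) exp(-s⁴)` against an oscillating function `u(ρ s)`. For
`p ≥ β - 1` the weight `s ^ (β - 1 - p) exp(-s⁴)` decreases, so after an integration by parts it is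
enough that the primitive of `s ^ p u(s)` be nonnegative (`integral_rpow_mul_exp_mul_pos`).

* For `N ≤ 2` one takes `u = cos` along each direction of the sphere and `p = -9/20`. The primitive
  of `s ^ (-9/20) cos s` is positive because the quarter period up to
  `π/2` outweighs the rest
  (`integral_rpow_mul_cos_pos`), and `11/20` is a threshold.
* For `N ≥ 3` the spherical average `u(z) = ∫ cos(z ω₀) dσ(ω)` solves a Bessel equation, and for
  `p = (N - 1)/2` the function `y = z ^ p u` solves `y'' = -Q y` with `Q(z) = 1 - p(p - 1)/z²`
  nondecreasing. Reflecting each negative arch of `y` about the zero where it begins and comparing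
  by Sturm's theorem shows that the primitive of `y` is nonnegative (`integral_nonneg_of_sturm`).
  This gives positivity for `β ≤ (N + 1)/2`. The threshold has to be strictly larger: on bounded
  sets positivity persists for slightly larger `β` by compactness, and far from the origin
  `|x|^β S(1)|·|^(-β)(x) = 1 + O(1/|x|)` uniformly in `β` (`exists_powerEvolution_pos_of_lt`).
-/

open MeasureTheory Real
open scoped SchwartzMap FourierTransform

namespace BiharmonicHeat

/-! ### The fundamental solution -/

theorem exists_abs_polynomial_mul_gaussian_le (P : Polynomial ℝ) :
    ∃ C, ∀ x : ℝ, |P.eval x| * exp (-(x ^ 2 / 2)) ≤ C := by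
  induction P using Polynomial.induction_on' with
  | add p q hp hq =>
    obtain ⟨C, hC⟩ := hp
    obtain ⟨D, hD⟩ := hq
    refine ⟨C + D, fun x => ?_⟩
    rw [Polynomial.eval_add]
    calc |p.eval x + q.eval x| * exp (-(x ^ 2 / 2))
        ≤ (|p.eval x| + |q.eval x|) * exp (-(x ^ 2 / 2)) := by gcongr; exact abs_add_le _ _
      _ ≤ C + D := by rw [add_mul]; exact add_le_add (hC x) (hD x)
  | monomial n a =>
    refine ⟨|a| * (1 + 2 ^ n * (n.factorial : ℝ)), fun x => ?_⟩
    rw [Polynomial.eval_monomial, abs_mul, mul_assoc]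
    gcongr
    have h1 : |x ^ n| ≤ 1 + x ^ (2 * n) := by
      have h : |x ^ n| ^ 2 = x ^ (2 * n) := by rw [sq_abs]; ring
      nlinarith [sq_nonneg (|x ^ n| - 1), abs_nonneg (x ^ n)]
    have h2 : x ^ (2 * n) * exp (-(x ^ 2 / 2)) ≤ 2 ^ n * (n.factorial : ℝ) := by
      have h := Real.pow_div_factorial_le_exp (x ^ 2 / 2) (by positivity) n
      rw [div_le_iff₀ (by positivity), div_pow, ← pow_mul, div_le_iff₀ (by positivity)] at h
      rw [exp_neg, ← div_eq_mul_inv, div_le_iff₀ (exp_pos _)]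
      linarith
    have h3 : exp (-(x ^ 2 / 2)) ≤ 1 := exp_le_one_iff.2 (by nlinarith [sq_nonneg x])
    nlinarith [exp_pos (-(x ^ 2 / 2))]

/-- The Gaussian `y ↦ exp (-y² / 2)` as a Schwartz function on the line; all its derivatives are
Hermite polynomials times the Gaussian. -/
noncomputable def gaussianSchwartz : 𝓢(ℝ, ℝ) where
  toFun y := exp (-(y ^ 2 / 2))
  smooth' := by fun_prop
  decay' k n := by
    obtain ⟨C, hC⟩ := exists_abs_polynomial_mul_gaussian_le
      (Polynomial.X ^ k * (Polynomial.hermite n).map (Int.castRingHom ℝ))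
    refine ⟨C, fun x => ?_⟩
    rw [norm_iteratedFDeriv_eq_norm_iteratedDeriv, iteratedDeriv_eq_iterate,
      Polynomial.deriv_gaussian_eq_hermite_mul_gaussian]
    refine le_trans (le_of_eq ?_) (hC x)
    simp only [norm_mul, norm_pow, norm_neg, norm_one, one_pow, one_mul, Real.norm_eq_abs,
      Polynomial.eval_mul, Polynomial.eval_pow, Polynomial.eval_X, abs_mul, abs_pow, abs_exp,
      Polynomial.aeval_def, Polynomial.eval_map, algebraMap_int_eq]
    ring

section

variable {V : Type*} [NormedAddCommGroup V] [InnerProductSpace ℝ V]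

/-- The symbol `exp(-t|ξ|⁴)` is a Schwartz function, being the one-dimensional Gaussian composed
with the polynomial map `ξ ↦ √(2t) |ξ|²`. -/
theorem exists_schwartz_exp_neg_mul_norm_pow_four {t : ℝ} (ht : 0 < t) :
    ∃ φ : 𝓢(V, ℂ), ∀ ξ, φ ξ = ((exp (-t * ‖ξ‖ ^ 4) : ℝ) : ℂ) := by
  have hg : Function.HasTemperateGrowth (fun ξ : V => √(2 * t) * ‖ξ‖ ^ 2) :=
    (Function.HasTemperateGrowth.const _).mul (Function.hasTemperateGrowth_norm_sq V)
  have hs : 0 < √(2 * t) := by positivity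
  have hu : ∃ (k : ℕ) (C : ℝ), ∀ ξ : V, ‖ξ‖ ≤ C * (1 + ‖√(2 * t) * ‖ξ‖ ^ 2‖) ^ k := by
    refine ⟨1, 1 + (√(2 * t))⁻¹, fun ξ => ?_⟩
    rw [Real.norm_of_nonneg (by positivity), pow_one]
    have h1 : ‖ξ‖ ≤ 1 + ‖ξ‖ ^ 2 := by nlinarith [sq_nonneg (‖ξ‖ - 1), norm_nonneg ξ]
    have h2 : (1 + (√(2 * t))⁻¹) * (1 + √(2 * t) * ‖ξ‖ ^ 2)
      = 1 + ‖ξ‖ ^ 2 + (√(2 * t))⁻¹ + √(2 * t) * ‖ξ‖ ^ 2 := by field_simp; ring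
    have h3 : 0 ≤ (√(2 * t))⁻¹ + √(2 * t) * ‖ξ‖ ^ 2 := by positivity
    linarith
  refine ⟨SchwartzMap.postcompCLM Complex.ofRealCLM
    (SchwartzMap.compCLM ℝ hg hu gaussianSchwartz), fun ξ => ?_⟩
  rw [SchwartzMap.postcompCLM_apply, SchwartzMap.compCLM_apply]
  simp only [Function.comp_apply, Complex.ofRealCLM_apply]
  congr 1
  change exp (-((√(2 * t) * ‖ξ‖ ^ 2) ^ 2 / 2)) = _
  rw [mul_pow, Real.sq_sqrt (by positivity)]
  ring_nf

variable [FiniteDimensional ℝ V] [MeasurableSpace V] [BorelSpace V]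

theorem integrable_exp_neg_mul_norm_pow_four {t : ℝ} (ht : 0 < t) :
    Integrable fun ξ : V => exp (-t * ‖ξ‖ ^ 4) := by
  obtain ⟨φ, hφ⟩ := exists_schwartz_exp_neg_mul_norm_pow_four (V := V) ht
  have h := φ.integrable (μ := volume)
  rw [show (φ : V → ℂ) = fun ξ => ((exp (-t * ‖ξ‖ ^ 4) : ℝ) : ℂ) from funext hφ] at h
  simpa only [RCLike.re_to_complex, Complex.ofReal_re] using h.re

theorem integral_mul_sin_inner_eq_zero {g : ℝ → ℝ} (x : V) :
    ∫ ξ : V, g ‖ξ‖ * sin (inner ℝ x ξ) = 0 := by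
  have h := integral_neg_eq_self (fun ξ : V => g ‖ξ‖ * sin (inner ℝ x ξ)) volume
  simp only [norm_neg, inner_neg_right, sin_neg, mul_neg, integral_neg] at h
  linarith

end

variable {N : ℕ}

/-- The kernel is the Fourier transform of its symbol, up to the factor `2π` in Mathlib's
normalisation of the frequency variable. -/
theorem fundSol_eq_fourier {t : ℝ} (ht : 0 < t) (φ : 𝓢(EuclideanSpace ℝ (Fin N), ℂ))
    (hφ : ∀ ξ, φ ξ = ((exp (-t * ‖ξ‖ ^ 4) : ℝ) : ℂ)) (x : EuclideanSpace ℝ (Fin N)) :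
    ((fundSol N x t : ℝ) : ℂ) = (((2 * π) ^ N)⁻¹ : ℝ) * (𝓕 φ) ((2 * π)⁻¹ • x) := by
  have hi := integrable_exp_neg_mul_norm_pow_four (V := EuclideanSpace ℝ (Fin N)) ht
  have hc : Integrable fun ξ : EuclideanSpace ℝ (Fin N) =>
      exp (-t * ‖ξ‖ ^ 4) * cos (inner ℝ x ξ) :=
    hi.mul_bdd (c := 1) (by fun_prop) (.of_forall fun ξ => by simpa using abs_cos_le_one _)
  have hs : Integrable fun ξ : EuclideanSpace ℝ (Fin N) =>
      exp (-t * ‖ξ‖ ^ 4) * sin (inner ℝ x ξ) :=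
    hi.mul_bdd (c := 1) (by fun_prop) (.of_forall fun ξ => by simpa using abs_sin_le_one _)
  rw [fundSol, SchwartzMap.fourier_coe, Real.fourier_eq', Complex.ofReal_mul,
    ← integral_complex_ofReal]
  congr 1
  have h0 : ∫ ξ : EuclideanSpace ℝ (Fin N),
      ((exp (-t * ‖ξ‖ ^ 4) * sin (inner ℝ x ξ) : ℝ) : ℂ) = 0 := by
    rw [integral_complex_ofReal, integral_mul_sin_inner_eq_zero (g := fun r => exp (-t * r ^ 4))]
    simp
  -- The imaginary part integrates to zero, so it may be subtracted to complete the exponential.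
  have hsub : ∫ ξ : EuclideanSpace ℝ (Fin N), ((exp (-t * ‖ξ‖ ^ 4) * cos (inner ℝ x ξ) : ℝ) : ℂ) =
      ∫ ξ : EuclideanSpace ℝ (Fin N), (((exp (-t * ‖ξ‖ ^ 4) * cos (inner ℝ x ξ) : ℝ) : ℂ) -
        ((exp (-t * ‖ξ‖ ^ 4) * sin (inner ℝ x ξ) : ℝ) : ℂ) * Complex.I) := by
    rw [integral_sub hc.ofReal (hs.ofReal.mul_const _), integral_mul_const, h0]
    simp
  rw [hsub]
  refine integral_congr_ae (.of_forall fun ξ => ?_)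
  simp only [smul_eq_mul, hφ]
  have harg : (((-2 * π * inner ℝ ξ ((2 * π)⁻¹ • x) : ℝ)) : ℂ) * Complex.I
      = ((-inner ℝ x ξ : ℝ) : ℂ) * Complex.I := by
    rw [inner_smul_right, real_inner_comm]
    congr 2
    field_simp
  rw [harg, Complex.exp_mul_I, ← Complex.ofReal_cos, ← Complex.ofReal_sin, cos_neg, sin_neg]
  push_cast
  ring

theorem continuous_fundSol {t : ℝ} (ht : 0 < t) :
    Continuous fun x : EuclideanSpace ℝ (Fin N) => fundSol N x t := by
  obtain ⟨φ, hφ⟩ := exists_schwartz_exp_neg_mul_norm_pow_four (V := EuclideanSpace ℝ (Fin N)) ht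
  have h : (fun x : EuclideanSpace ℝ (Fin N) => fundSol N x t) = fun x : EuclideanSpace ℝ (Fin N) =>
      (((((2 * π) ^ N)⁻¹ : ℝ) : ℂ) * (𝓕 φ) ((2 * π)⁻¹ • x)).re := by
    funext x
    rw [← fundSol_eq_fourier ht φ hφ, Complex.ofReal_re]
  rw [h]
  have := (𝓕 φ).continuous
  fun_prop

theorem exists_abs_fundSol_le {t : ℝ} (ht : 0 < t) (k : ℕ) :
    ∃ C, 0 < C ∧ ∀ x : EuclideanSpace ℝ (Fin N), |fundSol N x t| ≤ C * (1 + ‖x‖) ^ (-(k : ℝ)) := by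
  obtain ⟨φ, hφ⟩ := exists_schwartz_exp_neg_mul_norm_pow_four (V := EuclideanSpace ℝ (Fin N)) ht
  set D := 2 ^ k * ((Finset.Iic (k, 0)).sup fun m => SchwartzMap.seminorm ℝ m.1 m.2) (𝓕 φ)
    with hD
  have hb : ∀ y : EuclideanSpace ℝ (Fin N), (1 + ‖y‖) ^ k * ‖(𝓕 φ) y‖ ≤ D := fun y => by
    simpa using SchwartzMap.one_add_le_sup_seminorm_apply (𝕜 := ℝ) (m := (k, 0)) le_rfl le_rfl
      (𝓕 φ) y
  have hD0 : 0 ≤ D := le_trans (by positivity) (hb 0)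
  have hp : (1 : ℝ) ≤ 2 * π := by linarith [Real.pi_gt_three]
  refine ⟨((2 * π) ^ N)⁻¹ * ((2 * π) ^ k * D) + 1, by positivity, fun x => ?_⟩
  have h1 : |fundSol N x t| = ((2 * π) ^ N)⁻¹ * ‖(𝓕 φ) ((2 * π)⁻¹ • x)‖ := by
    rw [← Real.norm_eq_abs, ← Complex.norm_real, fundSol_eq_fourier ht φ hφ, norm_mul,
      Complex.norm_real, Real.norm_of_nonneg (by positivity)]
  have h2 := hb ((2 * π)⁻¹ • x)
  rw [norm_smul, Real.norm_of_nonneg (by positivity)] at h2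
  have h3 : (1 + ‖x‖) ^ k ≤ (2 * π) ^ k * (1 + (2 * π)⁻¹ * ‖x‖) ^ k := by
    rw [← mul_pow]
    gcongr
    have : 2 * π * (1 + (2 * π)⁻¹ * ‖x‖) = 2 * π + ‖x‖ := by field_simp
    linarith
  have hx : 0 < (1 + ‖x‖) ^ k := by positivity
  rw [rpow_neg (by positivity), rpow_natCast, ← div_eq_mul_inv, le_div_iff₀ hx, h1]
  calc ((2 * π) ^ N)⁻¹ * ‖(𝓕 φ) ((2 * π)⁻¹ • x)‖ * (1 + ‖x‖) ^ k
      ≤ ((2 * π) ^ N)⁻¹ * ‖(𝓕 φ) ((2 * π)⁻¹ • x)‖ *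
          ((2 * π) ^ k * (1 + (2 * π)⁻¹ * ‖x‖) ^ k) := by gcongr
    _ = ((2 * π) ^ N)⁻¹ * ((2 * π) ^ k *
          ((1 + (2 * π)⁻¹ * ‖x‖) ^ k * ‖(𝓕 φ) ((2 * π)⁻¹ • x)‖)) := by ring
    _ ≤ ((2 * π) ^ N)⁻¹ * ((2 * π) ^ k * D) := by gcongr
    _ ≤ _ := by linarith

theorem integral_fundSol {t : ℝ} (ht : 0 < t) :
    ∫ x : EuclideanSpace ℝ (Fin N), fundSol N x t = 1 := by
  obtain ⟨φ, hφ⟩ := exists_schwartz_exp_neg_mul_norm_pow_four (V := EuclideanSpace ℝ (Fin N)) ht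
  have h1 : ∫ x : EuclideanSpace ℝ (Fin N), ((fundSol N x t : ℝ) : ℂ) =
      ∫ x : EuclideanSpace ℝ (Fin N), (𝓕 φ) x := by
    simp_rw [fundSol_eq_fourier ht φ hφ]
    rw [integral_const_mul, Measure.integral_comp_smul]
    have hd : |(((2 * π)⁻¹ ^ N : ℝ))⁻¹| = (2 * π) ^ N := by
      rw [abs_of_pos (by positivity), inv_pow, inv_inv]
    rw [finrank_euclideanSpace_fin, hd, Complex.real_smul, ← mul_assoc, ← Complex.ofReal_mul,
      inv_mul_cancel₀ (by positivity)]
    simp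
  have h2 : ∫ x : EuclideanSpace ℝ (Fin N), (𝓕 φ) x = φ 0 := by
    have h : (𝓕⁻ (𝓕 φ)) (0 : EuclideanSpace ℝ (Fin N)) = φ 0 := by
      rw [FourierTransform.fourierInv_fourier_eq]
    rw [← h, SchwartzMap.fourierInv_coe, Real.fourierInv_eq']
    simp
  rw [integral_complex_ofReal, h2, hφ] at h1
  have h3 := Complex.ofReal_injective h1
  rw [h3]
  simp

/-! ### Convolution of decaying weights with powers -/

section

variable {N : ℕ} [NeZero N]

theorem integrableOn_ball_norm_rpow_neg {γ : ℝ} (hγ : γ < N) :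
    IntegrableOn (fun y : EuclideanSpace ℝ (Fin N) => ‖y‖ ^ (-γ)) (Metric.ball 0 1) := by
  have hN : 1 ≤ N := NeZero.one_le
  rw [integrableOn_fun_norm_addHaar volume (f := fun r : ℝ => r ^ (-γ))]
  have h : IntegrableOn (fun r : ℝ => r ^ ((N : ℝ) - 1 - γ)) (Set.Ioo 0 1) := by
    rw [← intervalIntegrable_iff_integrableOn_Ioo_of_le zero_le_one]
    exact intervalIntegral.intervalIntegrable_rpow' (by linarith)
  refine h.congr_fun (fun r hr => ?_) measurableSet_Ioo
  simp only [finrank_euclideanSpace_fin, smul_eq_mul]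
  rw [sub_eq_add_neg ((N : ℝ) - 1), rpow_add hr.1, ← rpow_natCast, Nat.cast_sub hN, Nat.cast_one]

end

variable {N : ℕ}

/-- The integrable majorant `(1 + ‖y‖) ^ (-(2N + 1))`. The exponent leaves room for a factor
`‖y‖ ^ γ` with `γ ≤ N`. -/
noncomputable def decayWeight (N : ℕ) (y : EuclideanSpace ℝ (Fin N)) : ℝ :=
  (1 + ‖y‖) ^ (-((2 * N + 1 : ℕ) : ℝ))

theorem decayWeight_pos (y : EuclideanSpace ℝ (Fin N)) : 0 < decayWeight N y := by
  unfold decayWeight; positivity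

theorem continuous_decayWeight : Continuous (decayWeight N) := by
  unfold decayWeight
  exact (by fun_prop : Continuous fun y : EuclideanSpace ℝ (Fin N) => 1 + ‖y‖).rpow_const
    fun y => .inl (by positivity)

theorem integrable_one_add_norm_rpow {r : ℝ} (hr : (N : ℝ) < r) :
    Integrable fun y : EuclideanSpace ℝ (Fin N) => (1 + ‖y‖) ^ (-r) :=
  integrable_one_add_norm (by simpa using hr)

theorem integrable_decayWeight : Integrable (decayWeight N) :=
  integrable_one_add_norm_rpow (by push_cast; linarith [(Nat.cast_nonneg N : (0 : ℝ) ≤ N)])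

theorem decayWeight_le_one (y : EuclideanSpace ℝ (Fin N)) : decayWeight N y ≤ 1 :=
  rpow_le_one_of_one_le_of_nonpos (by linarith [norm_nonneg y]) (neg_nonpos.2 (Nat.cast_nonneg _))

theorem decayWeight_mul_norm_rpow_le {γ : ℝ} (h0 : 0 ≤ γ) (hγ : γ ≤ N)
    (y : EuclideanSpace ℝ (Fin N)) :
    decayWeight N y * ‖y‖ ^ γ ≤ (1 + ‖y‖) ^ (-((N : ℝ) + 1)) := by
  have h1 : 1 ≤ 1 + ‖y‖ := by linarith [norm_nonneg y]
  calc decayWeight N y * ‖y‖ ^ γ ≤ decayWeight N y * (1 + ‖y‖) ^ (N : ℝ) := by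
        gcongr
        · exact (decayWeight_pos y).le
        · exact (rpow_le_rpow (norm_nonneg y) (by linarith) h0).trans
            (rpow_le_rpow_of_exponent_le h1 hγ)
    _ = _ := by
        rw [decayWeight, ← rpow_add (by linarith)]
        congr 1
        push_cast
        ring

/-- Near the origin `m` is bounded by `A` and the power by an integrable one; away from the origin
the power is at most `1`. -/
theorem integrable_and_integral_mul_norm_rpow_neg_le [NeZero N] {γ Γ A : ℝ} (hγ : 0 ≤ γ)
    (hΓ : γ ≤ Γ) (hN : Γ < N) {m : EuclideanSpace ℝ (Fin N) → ℝ} (hm : Integrable m)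
    (h0 : ∀ y, 0 ≤ m y) (hA : ∀ y, m y ≤ A) (x : EuclideanSpace ℝ (Fin N)) :
    Integrable (fun y => m (x - y) * ‖y‖ ^ (-γ)) ∧
    ∫ y, m (x - y) * ‖y‖ ^ (-γ) ≤
      A * (∫ y in Metric.ball (0 : EuclideanSpace ℝ (Fin N)) 1, ‖y‖ ^ (-Γ)) + ∫ y, m y := by
  have hA0 : 0 ≤ A := (h0 0).trans (hA 0)
  set F : EuclideanSpace ℝ (Fin N) → ℝ := fun y =>
    A * (Metric.ball (0 : EuclideanSpace ℝ (Fin N)) 1).indicator (fun y => ‖y‖ ^ (-Γ)) y + m (x - y)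
    with hF
  have h1 : Integrable ((Metric.ball (0 : EuclideanSpace ℝ (Fin N)) 1).indicator
      (fun y => ‖y‖ ^ (-Γ))) :=
    (integrable_indicator_iff measurableSet_ball).2 (integrableOn_ball_norm_rpow_neg hN)
  have h2 : Integrable fun y => m (x - y) := hm.comp_sub_left x
  have hFi : Integrable F := (h1.const_mul A).add h2
  have hle : ∀ y, y ≠ 0 → m (x - y) * ‖y‖ ^ (-γ) ≤ F y := fun y hy => by
    have hy0 : 0 < ‖y‖ := norm_pos_iff.2 hy
    by_cases hb : ‖y‖ < 1
    · have : y ∈ Metric.ball (0 : EuclideanSpace ℝ (Fin N)) 1 := by simpa using hb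
      simp only [hF, Set.indicator_of_mem this]
      have h3 : ‖y‖ ^ (-γ) ≤ ‖y‖ ^ (-Γ) :=
        rpow_le_rpow_of_exponent_ge hy0 hb.le (by linarith)
      have h4 : m (x - y) * ‖y‖ ^ (-γ) ≤ A * ‖y‖ ^ (-Γ) :=
        mul_le_mul (hA _) h3 (by positivity) hA0
      linarith [h0 (x - y)]
    · have : y ∉ Metric.ball (0 : EuclideanSpace ℝ (Fin N)) 1 := by simpa using hb
      simp only [hF, Set.indicator_of_notMem this, mul_zero, zero_add]
      exact mul_le_of_le_one_right (h0 _)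
        (rpow_le_one_of_one_le_of_nonpos (not_lt.1 hb) (by linarith))
  have hae : ∀ᵐ y : EuclideanSpace ℝ (Fin N), y ≠ 0 := by
    simp [ae_iff, measure_singleton]
  have hi : Integrable (fun y => m (x - y) * ‖y‖ ^ (-γ)) := by
    refine hFi.mono' (h2.aestronglyMeasurable.mul
      (Measurable.aestronglyMeasurable (by fun_prop))) ?_
    filter_upwards [hae] with y hy
    rw [norm_of_nonneg (mul_nonneg (h0 _) (by positivity))]
    exact hle y hy
  refine ⟨hi, (integral_mono_ae hi hFi (hae.mono hle)).trans (le_of_eq ?_)⟩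
  rw [integral_add (h1.const_mul A) h2, integral_const_mul, integral_indicator measurableSet_ball,
    integral_sub_left_eq_self m volume x]

theorem add_rpow_le_two_rpow_mul {a b γ : ℝ} (ha : 0 ≤ a) (hb : 0 ≤ b) (hγ : 0 ≤ γ) :
    (a + b) ^ γ ≤ 2 ^ γ * (a ^ γ + b ^ γ) := by
  have h : ∀ {u v : ℝ}, 0 ≤ u → u ≤ v → (u + v) ^ γ ≤ 2 ^ γ * (u ^ γ + v ^ γ) := by
    intro u v hu huv
    calc (u + v) ^ γ ≤ (2 * v) ^ γ := rpow_le_rpow (by linarith) (by linarith) hγ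
      _ = 2 ^ γ * v ^ γ := mul_rpow (by norm_num) (by linarith)
      _ ≤ _ := by gcongr; linarith [rpow_nonneg hu γ]
  rcases le_total a b with hab | hab
  · exact h ha hab
  · rw [add_comm a, add_comm (a ^ γ)]; exact h hb hab

/-- Convolving `‖y‖ ^ (-γ)` with a rapidly decaying weight smooths the singularity at the origin
and keeps the decay rate at infinity; the constant is uniform for `γ` in a compact subset of
`[0, N)`. -/
theorem exists_integral_decayWeight_mul_norm_rpow_neg_le [NeZero N] {Γ : ℝ} (hN : Γ < N) :
    ∃ C, 0 < C ∧ ∀ γ, 0 ≤ γ → γ ≤ Γ → ∀ x : EuclideanSpace ℝ (Fin N),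
      Integrable (fun y => decayWeight N (x - y) * ‖y‖ ^ (-γ)) ∧
      ∫ y, decayWeight N (x - y) * ‖y‖ ^ (-γ) ≤ C * (1 + ‖x‖) ^ (-γ) := by
  set L := ∫ y in Metric.ball (0 : EuclideanSpace ℝ (Fin N)) 1, ‖y‖ ^ (-Γ) with hL
  have hL0 : 0 ≤ L := integral_nonneg fun y => by positivity
  set B := ∫ y : EuclideanSpace ℝ (Fin N), decayWeight N y with hB
  have hB0 : 0 ≤ B := integral_nonneg fun y => (decayWeight_pos y).le
  set D := ∫ y : EuclideanSpace ℝ (Fin N), (1 + ‖y‖) ^ (-((N : ℝ) + 1)) with hD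
  have hD0 : 0 ≤ D := integral_nonneg fun y => by positivity
  refine ⟨2 ^ (N : ℝ) * ((L + B) + 2 ^ (N : ℝ) * ((L + D) + B)) + 1, by positivity,
    fun γ h0 hγ x => ?_⟩
  obtain ⟨hi, hb⟩ := integrable_and_integral_mul_norm_rpow_neg_le h0 hγ hN integrable_decayWeight
    (fun y => (decayWeight_pos y).le) decayWeight_le_one x
  refine ⟨hi, ?_⟩
  set m : EuclideanSpace ℝ (Fin N) → ℝ := fun y => (1 + ‖y‖) ^ (-((N : ℝ) + 1)) with hm
  have hmi : Integrable m := integrable_one_add_norm_rpow (by linarith)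
  obtain ⟨hi', hb'⟩ := integrable_and_integral_mul_norm_rpow_neg_le h0 hγ hN hmi
    (fun y => by positivity) (fun y => rpow_le_one_of_one_le_of_nonpos
      (by linarith [norm_nonneg y]) (by linarith [(Nat.cast_nonneg N : (0 : ℝ) ≤ N)])) x
  rw [one_mul] at hb hb'
  set I := ∫ y, decayWeight N (x - y) * ‖y‖ ^ (-γ) with hI
  have hI0 : 0 ≤ I := integral_nonneg fun y => mul_nonneg (decayWeight_pos _).le (by positivity)
  have h2 : ((2 : ℝ) ^ γ) ≤ 2 ^ (N : ℝ) := rpow_le_rpow_of_exponent_le (by norm_num) (by linarith)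
  have hwi : Integrable fun y => decayWeight N (x - y) := integrable_decayWeight.comp_sub_left x
  have hx : ‖x‖ ^ γ * I ≤ 2 ^ (N : ℝ) * ((L + D) + B) := by
    have hpt : ∀ y, ‖x‖ ^ γ * (decayWeight N (x - y) * ‖y‖ ^ (-γ)) ≤
        2 ^ γ * (m (x - y) * ‖y‖ ^ (-γ) + decayWeight N (x - y)) := fun y => by
      have h3 : ‖x‖ ^ γ ≤ 2 ^ γ * (‖x - y‖ ^ γ + ‖y‖ ^ γ) :=
        (rpow_le_rpow (norm_nonneg x) (by simpa using norm_add_le (x - y) y) h0).trans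
          (add_rpow_le_two_rpow_mul (norm_nonneg _) (norm_nonneg _) h0)
      have h4 := decayWeight_mul_norm_rpow_le h0 (hγ.trans hN.le) (x - y)
      have h5 : ‖y‖ ^ γ * ‖y‖ ^ (-γ) ≤ 1 := by
        rw [rpow_neg (norm_nonneg y)]; exact mul_inv_le_one
      have hw := (decayWeight_pos (x - y)).le
      calc ‖x‖ ^ γ * (decayWeight N (x - y) * ‖y‖ ^ (-γ))
          ≤ 2 ^ γ * (‖x - y‖ ^ γ + ‖y‖ ^ γ) * (decayWeight N (x - y) * ‖y‖ ^ (-γ)) := by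
            gcongr
        _ = 2 ^ γ * (decayWeight N (x - y) * ‖x - y‖ ^ γ * ‖y‖ ^ (-γ) +
              decayWeight N (x - y) * (‖y‖ ^ γ * ‖y‖ ^ (-γ))) := by ring
        _ ≤ 2 ^ γ * (m (x - y) * ‖y‖ ^ (-γ) + decayWeight N (x - y) * 1) := by gcongr
        _ = _ := by rw [mul_one]
    calc ‖x‖ ^ γ * I = ∫ y, ‖x‖ ^ γ * (decayWeight N (x - y) * ‖y‖ ^ (-γ)) := by
          rw [integral_const_mul]
      _ ≤ ∫ y, 2 ^ γ * (m (x - y) * ‖y‖ ^ (-γ) + decayWeight N (x - y)) :=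
          integral_mono (hi.const_mul _) ((hi'.add hwi).const_mul _) hpt
      _ = 2 ^ γ * ((∫ y, m (x - y) * ‖y‖ ^ (-γ)) + B) := by
          rw [integral_const_mul, integral_add hi' hwi,
            integral_sub_left_eq_self (decayWeight N) volume x]
      _ ≤ 2 ^ (N : ℝ) * ((L + D) + B) := by gcongr
  have hfin : (1 + ‖x‖) ^ γ * I ≤ 2 ^ (N : ℝ) * ((L + B) + 2 ^ (N : ℝ) * ((L + D) + B)) := by
    calc (1 + ‖x‖) ^ γ * I ≤ 2 ^ γ * (1 ^ γ + ‖x‖ ^ γ) * I := by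
          gcongr; exact add_rpow_le_two_rpow_mul zero_le_one (norm_nonneg _) h0
      _ = 2 ^ γ * (I + ‖x‖ ^ γ * I) := by rw [one_rpow]; ring
      _ ≤ _ := by gcongr
  have hp : 0 < (1 + ‖x‖) ^ γ := by positivity
  rw [rpow_neg (by positivity), ← div_eq_mul_inv, le_div_iff₀ hp]
  linarith

/-! ### Scaling, and the evolution of Riesz potentials -/

variable {N : ℕ}

theorem fundSol_smul {R : ℝ} (hR : 0 < R) (x : EuclideanSpace ℝ (Fin N)) :
    fundSol N (R • x) (R ^ 4) = (R ^ N)⁻¹ * fundSol N x 1 := by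
  have h := Measure.integral_comp_smul volume
    (fun ξ : EuclideanSpace ℝ (Fin N) => exp (-1 * ‖ξ‖ ^ 4) * cos (inner ℝ x ξ)) R
  rw [finrank_euclideanSpace_fin, abs_of_pos (by positivity), smul_eq_mul] at h
  rw [fundSol, fundSol, mul_left_comm, ← h]
  congr 1
  refine integral_congr_ae (.of_forall fun ξ => ?_)
  simp only [norm_smul, inner_smul_left, inner_smul_right, Real.norm_of_nonneg hR.le, mul_pow]
  norm_num

/-- The evolution `S(t)|·|^(-β)` of a pure power. -/
noncomputable def powerEvolution (N : ℕ) (β t : ℝ) (x : EuclideanSpace ℝ (Fin N)) : ℝ :=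
  semigroup N t (fun y => ‖y‖ ^ (-β)) x

theorem powerEvolution_smul {R : ℝ} (hR : 0 < R) (β : ℝ) (x : EuclideanSpace ℝ (Fin N)) :
    powerEvolution N β (R ^ 4) (R • x) = R ^ (-β) * powerEvolution N β 1 x := by
  have h := Measure.integral_comp_smul volume
    (fun y : EuclideanSpace ℝ (Fin N) => fundSol N (R • x - y) (R ^ 4) * ‖y‖ ^ (-β)) R
  rw [finrank_euclideanSpace_fin, abs_of_pos (by positivity), smul_eq_mul,
    inv_mul_eq_div, eq_div_iff (by positivity)] at h
  rw [powerEvolution, semigroup, ← h, powerEvolution, semigroup, ← integral_const_mul,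
    ← integral_mul_const]
  refine integral_congr_ae (.of_forall fun y => ?_)
  simp only [← smul_sub, fundSol_smul hR, norm_smul, Real.norm_of_nonneg hR.le,
    mul_rpow hR.le (norm_nonneg y)]
  have : (R ^ N) ≠ 0 := by positivity
  field_simp

theorem powerEvolution_eq_smul {t : ℝ} (ht : 0 < t) (β : ℝ) (x : EuclideanSpace ℝ (Fin N)) :
    powerEvolution N β t x =
      (t ^ (1 / 4 : ℝ)) ^ (-β) * powerEvolution N β 1 ((t ^ (1 / 4 : ℝ))⁻¹ • x) := by
  have hR : 0 < t ^ (1 / 4 : ℝ) := by positivity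
  have hR4 : (t ^ (1 / 4 : ℝ)) ^ 4 = t := by
    rw [← rpow_natCast, ← rpow_mul ht.le]; norm_num
  rw [← powerEvolution_smul hR, hR4, smul_smul, mul_inv_cancel₀ hR.ne', one_smul]

theorem measurable_powerEvolution {t : ℝ} (ht : 0 < t) (β : ℝ) :
    Measurable (powerEvolution N β t) := by
  refine StronglyMeasurable.measurable (StronglyMeasurable.integral_prod_right
    (f := fun x y : EuclideanSpace ℝ (Fin N) => fundSol N (x - y) t * ‖y‖ ^ (-β)) ?_)
  refine Measurable.stronglyMeasurable ?_
  have h1 : Measurable fun p : EuclideanSpace ℝ (Fin N) × EuclideanSpace ℝ (Fin N) =>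
      fundSol N (p.1 - p.2) t := ((continuous_fundSol ht).comp (by fun_prop)).measurable
  exact h1.mul (by fun_prop)

theorem exists_abs_fundSol_le_decayWeight {t : ℝ} (ht : 0 < t) :
    ∃ C, 0 < C ∧ ∀ x, |fundSol N x t| ≤ C * decayWeight N x :=
  exists_abs_fundSol_le ht (2 * N + 1)

theorem integrable_fundSol_mul_norm_rpow_neg [NeZero N] {t β : ℝ} (ht : 0 < t) (h0 : 0 ≤ β)
    (hβ : β < N) (x : EuclideanSpace ℝ (Fin N)) :
    Integrable fun y => fundSol N (x - y) t * ‖y‖ ^ (-β) := by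
  obtain ⟨C, hC, hG⟩ := exists_abs_fundSol_le_decayWeight (N := N) ht
  obtain ⟨D, hD, hw⟩ := exists_integral_decayWeight_mul_norm_rpow_neg_le hβ
  refine ((hw β h0 le_rfl x).1.const_mul C).mono' (Measurable.aestronglyMeasurable ?_)
    (.of_forall fun y => ?_)
  · exact ((continuous_fundSol ht).comp (by fun_prop)).measurable.mul (by fun_prop)
  · rw [norm_mul, norm_eq_abs, Real.norm_of_nonneg (by positivity : 0 ≤ ‖y‖ ^ (-β)), ← mul_assoc]
    gcongr
    exact hG _

theorem exists_abs_powerEvolution_le [NeZero N] {t β : ℝ} (ht : 0 < t) (h0 : 0 ≤ β)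
    (hβ : β < N) :
    ∃ C, 0 < C ∧ ∀ x, |powerEvolution N β t x| ≤ C * (1 + ‖x‖) ^ (-β) := by
  obtain ⟨C, hC, hG⟩ := exists_abs_fundSol_le_decayWeight (N := N) ht
  obtain ⟨D, hD, hw⟩ := exists_integral_decayWeight_mul_norm_rpow_neg_le hβ
  refine ⟨C * D, by positivity, fun x => ?_⟩
  obtain ⟨hi, hb⟩ := hw β h0 le_rfl x
  calc |powerEvolution N β t x| ≤ ∫ y, C * (decayWeight N (x - y) * ‖y‖ ^ (-β)) := by
        rw [powerEvolution, semigroup, ← Real.norm_eq_abs]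
        refine norm_integral_le_of_norm_le (hi.const_mul C) (.of_forall fun y => ?_)
        rw [norm_mul, norm_eq_abs, Real.norm_of_nonneg (by positivity : 0 ≤ ‖y‖ ^ (-β)),
          ← mul_assoc]
        gcongr
        exact hG _
    _ = C * ∫ y, decayWeight N (x - y) * ‖y‖ ^ (-β) := integral_const_mul _ _
    _ ≤ C * (D * (1 + ‖x‖) ^ (-β)) := by gcongr
    _ = _ := by ring

theorem memLp_one_add_norm_rpow_neg {β p : ℝ} (hp : 0 < p) (h : (N : ℝ) < β * p)
    (x : EuclideanSpace ℝ (Fin N)) :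
    MemLp (fun z => (1 + ‖x - z‖) ^ (-β)) (ENNReal.ofReal p) := by
  have hm : Measurable fun z : EuclideanSpace ℝ (Fin N) => (1 + ‖x - z‖) ^ (-β) := by fun_prop
  rw [← integrable_norm_rpow_iff hm.aestronglyMeasurable (by simpa using hp) (by simp),
    ENNReal.toReal_ofReal hp.le]
  have h1 := (integrable_one_add_norm_rpow h).comp_sub_left x
  refine h1.congr (.of_forall fun z => ?_)
  simp only
  rw [Real.norm_of_nonneg (by positivity), ← rpow_mul (by positivity), neg_mul]

/-- The double integral behind `S(t)ψ` converges absolutely, even with the kernel replaced by its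
strictly positive majorant. -/
theorem integrable_decayWeight_mul_div_norm_rpow [NeZero N] {β q q' : ℝ} (h0 : 0 ≤ β) (hβ : β < N)
    (hq : q.HolderConjugate q') (hN : (N : ℝ) < β * q') {f : EuclideanSpace ℝ (Fin N) → ℝ}
    (hf : MemLp f (ENNReal.ofReal q)) (x : EuclideanSpace ℝ (Fin N)) :
    Integrable (fun p : EuclideanSpace ℝ (Fin N) × EuclideanSpace ℝ (Fin N) =>
      decayWeight N (x - p.1) * (f p.2 / ‖p.1 - p.2‖ ^ β)) (volume.prod volume) := by
  obtain ⟨D, hD, hw⟩ := exists_integral_decayWeight_mul_norm_rpow_neg_le hβ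
  have hw' := hw β h0 le_rfl
  have hshift : ∀ y z : EuclideanSpace ℝ (Fin N), decayWeight N (x - y) * (f z / ‖y - z‖ ^ β) =
      f z * (decayWeight N ((x - z) - (y - z)) * ‖y - z‖ ^ (-β)) := fun y z => by
    rw [sub_sub_sub_cancel_right, rpow_neg (norm_nonneg _)]
    ring
  have hm : AEStronglyMeasurable
      (fun p : EuclideanSpace ℝ (Fin N) × EuclideanSpace ℝ (Fin N) =>
        decayWeight N (x - p.1) * (f p.2 / ‖p.1 - p.2‖ ^ β)) (volume.prod volume) := by
    simp only [div_eq_mul_inv]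
    refine AEStronglyMeasurable.mul (Continuous.aestronglyMeasurable ?_)
      (hf.1.comp_snd.mul (Measurable.aestronglyMeasurable (by fun_prop)))
    exact continuous_decayWeight.comp (by fun_prop)
  refine (integrable_prod_iff' hm).2 ⟨.of_forall fun z => ?_, ?_⟩
  · simp only [hshift]
    exact ((hw' (x - z)).1.comp_sub_right z).const_mul (f z)
  · have hint : ∀ z, ∫ y, ‖decayWeight N (x - y) * (f z / ‖y - z‖ ^ β)‖ =
        ‖f z‖ * ∫ y, decayWeight N ((x - z) - y) * ‖y‖ ^ (-β) := fun z => by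
      rw [← integral_sub_right_eq_self (fun y => decayWeight N ((x - z) - y) * ‖y‖ ^ (-β)) z,
        ← integral_const_mul]
      refine integral_congr_ae (.of_forall fun y => ?_)
      simp only [hshift]
      rw [norm_mul, Real.norm_of_nonneg
        (mul_nonneg (decayWeight_pos ((x - z) - (y - z))).le (by positivity))]
    have hc := hq.ennrealOfReal
    have hprod := (MemLp.integrable_mul hf.norm
      (memLp_one_add_norm_rpow_neg hq.symm.pos hN x)).const_mul D
    refine hprod.mono' hm.norm.prod_swap.integral_prod_right' (.of_forall fun z => ?_)
    simp only [Pi.mul_apply]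
    rw [Real.norm_of_nonneg (integral_nonneg fun y => norm_nonneg _), hint, mul_left_comm]
    gcongr
    exact (hw' (x - z)).2

section potential

variable [NeZero N] {β q q' : ℝ} {f : EuclideanSpace ℝ (Fin N) → ℝ}

theorem ae_integrable_div_norm_rpow (h0 : 0 ≤ β) (hβ : β < N)
    (hq : q.HolderConjugate q') (hN : (N : ℝ) < β * q') (hf : MemLp f (ENNReal.ofReal q)) :
    ∀ᵐ x, Integrable fun y => f y / ‖x - y‖ ^ β := by
  filter_upwards [(integrable_decayWeight_mul_div_norm_rpow h0 hβ hq hN hf 0).prod_right_ae]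
    with y hy
  refine (hy.const_mul (decayWeight N (0 - y))⁻¹).congr (.of_forall fun z => ?_)
  simp only
  rw [inv_mul_cancel_left₀ (decayWeight_pos _).ne']

theorem integrable_fundSol_mul_div_norm_rpow (h0 : 0 ≤ β) (hβ : β < N)
    (hq : q.HolderConjugate q') (hN : (N : ℝ) < β * q') (hf : MemLp f (ENNReal.ofReal q))
    {t : ℝ} (ht : 0 < t) (x : EuclideanSpace ℝ (Fin N)) :
    Integrable (fun p : EuclideanSpace ℝ (Fin N) × EuclideanSpace ℝ (Fin N) =>
      fundSol N (x - p.1) t * (f p.2 / ‖p.1 - p.2‖ ^ β)) (volume.prod volume) := by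
  obtain ⟨C, hC, hG⟩ := exists_abs_fundSol_le_decayWeight (N := N) ht
  refine ((integrable_decayWeight_mul_div_norm_rpow h0 hβ hq hN hf x).norm.const_mul C).mono' ?_
    (.of_forall fun p => ?_)
  · simp only [div_eq_mul_inv]
    refine AEStronglyMeasurable.mul (Continuous.aestronglyMeasurable ?_)
      (hf.1.comp_snd.mul (Measurable.aestronglyMeasurable (by fun_prop)))
    exact (continuous_fundSol ht).comp (by fun_prop)
  · rw [norm_mul, norm_mul, ← mul_assoc, norm_eq_abs, Real.norm_of_nonneg (decayWeight_pos _).le]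
    gcongr
    exact hG _

theorem integrable_fundSol_mul_rieszPotential (h0 : 0 ≤ β) (hβ : β < N)
    (hq : q.HolderConjugate q') (hN : (N : ℝ) < β * q') (hf : MemLp f (ENNReal.ofReal q))
    {t : ℝ} (ht : 0 < t) (x : EuclideanSpace ℝ (Fin N)) :
    Integrable fun y => fundSol N (x - y) t * rieszPotential N β f y := by
  have h := (integrable_fundSol_mul_div_norm_rpow h0 hβ hq hN hf ht x).integral_prod_left
  simpa only [integral_const_mul, rieszPotential] using h

/-- `S(t)(f * |·|^(-β)) = f * S(t)|·|^(-β)`. -/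
theorem semigroup_rieszPotential_eq (h0 : 0 ≤ β) (hβ : β < N)
    (hq : q.HolderConjugate q') (hN : (N : ℝ) < β * q') (hf : MemLp f (ENNReal.ofReal q))
    {t : ℝ} (ht : 0 < t) (x : EuclideanSpace ℝ (Fin N)) :
    semigroup N t (rieszPotential N β f) x = ∫ z, f z * powerEvolution N β t (x - z) := by
  have h := integral_integral_swap (f := fun y z : EuclideanSpace ℝ (Fin N) =>
    fundSol N (x - y) t * (f z / ‖y - z‖ ^ β))
    (integrable_fundSol_mul_div_norm_rpow h0 hβ hq hN hf ht x)
  simp only [integral_const_mul] at h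
  rw [semigroup]
  simp only [rieszPotential]
  rw [h]
  refine integral_congr_ae (.of_forall fun z => ?_)
  simp only
  rw [powerEvolution, semigroup, ← integral_const_mul,
    ← integral_sub_right_eq_self (fun y => f z * (fundSol N ((x - z) - y) t * ‖y‖ ^ (-β))) z]
  refine integral_congr_ae (.of_forall fun y => ?_)
  simp only
  rw [sub_sub_sub_cancel_right, rpow_neg (norm_nonneg _)]
  ring

theorem memLp_powerEvolution (h0 : 0 ≤ β) (hβ : β < N) (hq : 0 < q') (hN : (N : ℝ) < β * q')
    {t : ℝ} (ht : 0 < t) (x : EuclideanSpace ℝ (Fin N)) :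
    MemLp (fun z => powerEvolution N β t (x - z)) (ENNReal.ofReal q') := by
  obtain ⟨C, hC, hb⟩ := exists_abs_powerEvolution_le (N := N) ht h0 hβ
  refine MemLp.mono' ((memLp_one_add_norm_rpow_neg hq hN x).const_mul C)
    ((measurable_powerEvolution ht β).comp (by fun_prop)).aestronglyMeasurable
    (.of_forall fun z => hb _)

theorem semigroup_rieszPotential_pos (h0 : 0 ≤ β) (hβ : β < N)
    (hq : q.HolderConjugate q') (hN : (N : ℝ) < β * q') (hf : MemLp f (ENNReal.ofReal q))
    (hf0 : ∀ᵐ y, 0 ≤ f y) (hne : ¬ ∀ᵐ y, f y = 0) {t : ℝ} (ht : 0 < t)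
    (hpos : ∀ x, 0 < powerEvolution N β t x) (x : EuclideanSpace ℝ (Fin N)) :
    0 < semigroup N t (rieszPotential N β f) x := by
  have hc := hq.ennrealOfReal
  have hi : Integrable fun z => f z * powerEvolution N β t (x - z) :=
    MemLp.integrable_mul hf (memLp_powerEvolution h0 hβ hq.symm.pos hN ht x)
  rw [semigroup_rieszPotential_eq h0 hβ hq hN hf ht]
  refine (integral_pos_iff_support_of_nonneg_ae
    (hf0.mono fun z hz => mul_nonneg hz (hpos _).le) hi).2 (pos_iff_ne_zero.2 fun h => hne ?_)
  rw [ae_iff]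
  refine measure_mono_null (fun z hz => ?_) h
  exact mul_ne_zero hz (hpos _).ne'

/-- Hölder's inequality for `f * S(t)|·|^(-β)`; the power of `t` is the scaling of the `L^{q'}` norm
of `S(t)|·|^(-β)`. -/
theorem abs_semigroup_rieszPotential_le (h0 : 0 ≤ β) (hβ : β < N)
    (hq : q.HolderConjugate q') (hN : (N : ℝ) < β * q') (hf : MemLp f (ENNReal.ofReal q))
    {t : ℝ} (ht : 0 < t) (x : EuclideanSpace ℝ (Fin N)) :
    |semigroup N t (rieszPotential N β f) x| ≤
      (∫ z, ‖powerEvolution N β 1 z‖ ^ q') ^ (1 / q') *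
        t ^ (-((N : ℝ) / 4) * (1 / q + β / (N : ℝ) - 1)) *
        (eLpNorm f (ENNReal.ofReal q) volume).toReal := by
  have hNpos : (0 : ℝ) < N := by exact_mod_cast (NeZero.pos N)
  set R := t ^ (1 / 4 : ℝ) with hRdef
  have hR : 0 < R := by positivity
  have hhol := integral_mul_norm_le_Lp_mul_Lq hq hf
    (memLp_powerEvolution h0 hβ hq.symm.pos hN ht x)
  have hfn : (eLpNorm f (ENNReal.ofReal q) volume).toReal = (∫ z, ‖f z‖ ^ q) ^ (1 / q) := by
    rw [hf.eLpNorm_eq_integral_rpow_norm (by simpa using hq.pos) (by simp),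
      ENNReal.toReal_ofReal hq.nonneg, ENNReal.toReal_ofReal (by positivity), one_div]
  set J := ∫ z, ‖powerEvolution N β 1 z‖ ^ q' with hJ
  have hJ0 : 0 ≤ J := integral_nonneg fun z => by positivity
  have hkn : ∫ z, ‖powerEvolution N β t (x - z)‖ ^ q' = (R ^ (-β)) ^ q' * (R ^ N * J) := by
    rw [integral_sub_left_eq_self (fun z => ‖powerEvolution N β t z‖ ^ q') volume x]
    have h := Measure.integral_comp_smul volume
      (fun z : EuclideanSpace ℝ (Fin N) => ‖powerEvolution N β 1 z‖ ^ q') R⁻¹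
    rw [finrank_euclideanSpace_fin, abs_of_pos (by positivity), inv_pow, inv_inv,
      smul_eq_mul] at h
    rw [hJ, ← h, ← integral_const_mul]
    refine integral_congr_ae (.of_forall fun z => ?_)
    simp only
    rw [powerEvolution_eq_smul ht, norm_mul, mul_rpow (norm_nonneg _) (norm_nonneg _),
      Real.norm_of_nonneg (by positivity : 0 ≤ (t ^ (1 / 4 : ℝ)) ^ (-β))]
  have hexp : ((R ^ (-β)) ^ q' * (R ^ N * J)) ^ (1 / q') =
      t ^ (-((N : ℝ) / 4) * (1 / q + β / (N : ℝ) - 1)) * J ^ (1 / q') := by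
    rw [← mul_assoc, mul_rpow (by positivity) hJ0]
    congr 1
    rw [← rpow_natCast, ← rpow_mul hR.le, ← rpow_add hR, ← rpow_mul hR.le, hRdef,
      ← rpow_mul ht.le]
    congr 1
    have h1 : 1 / q' = 1 - 1 / q := by
      have := hq.inv_add_inv_eq_one
      simp only [one_div]; linarith
    have h2 : q' * (1 / q') = 1 := by
      have := hq.symm.pos.ne'
      field_simp
    calc 1 / 4 * ((-β * q' + N) * (1 / q')) = 1 / 4 * (-β * (q' * (1 / q')) + N * (1 / q')) := by
          ring
      _ = _ := by rw [h2, h1]; field_simp; ring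
  rw [semigroup_rieszPotential_eq h0 hβ hq hN hf ht]
  calc |∫ z, f z * powerEvolution N β t (x - z)|
      ≤ ∫ z, ‖f z‖ * ‖powerEvolution N β t (x - z)‖ := by
        rw [← Real.norm_eq_abs]
        refine (norm_integral_le_integral_norm _).trans (le_of_eq ?_)
        simp only [norm_mul]
    _ ≤ _ := hhol
    _ = _ := by rw [hkn, hexp, hfn]; ring

end potential

/-! ### Reduction of positivity to a Fourier integral -/

/-- The Fourier transform of a Gaussian, in real form. -/
theorem integral_exp_neg_mul_sq_mul_cos_inner {V : Type*} [NormedAddCommGroup V]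
    [InnerProductSpace ℝ V] [FiniteDimensional ℝ V] [MeasurableSpace V] [BorelSpace V]
    {s : ℝ} (hs : 0 < s) (x ξ : V) :
    ∫ y : V, exp (-s * ‖y‖ ^ 2) * cos (inner ℝ (x - y) ξ) =
      (π / s) ^ (Module.finrank ℝ V / 2 : ℝ) * exp (-(‖ξ‖ ^ 2 / (4 * s))) *
        cos (inner ℝ x ξ) := by
  have h := GaussianFourier.integral_cexp_neg_mul_sq_norm_add (V := V) (b := (s : ℂ))
    (by simpa using hs) (-Complex.I) ξ
  have h2 : ∫ y : V, ((exp (-s * ‖y‖ ^ 2) * cos (inner ℝ (x - y) ξ) : ℝ) : ℂ) =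
      ∫ y : V, ((Complex.exp (-(s : ℂ) * ‖y‖ ^ 2 + -Complex.I * inner ℝ ξ y) *
        Complex.exp ((inner ℝ x ξ : ℝ) * Complex.I)).re : ℂ) := by
    refine integral_congr_ae (.of_forall fun y => ?_)
    simp only
    rw [← Complex.exp_add, Complex.exp_re]
    congr 2
    · congr 1
      simp [← Complex.ofReal_pow]
    · congr 1
      simp [← Complex.ofReal_pow, inner_sub_left, real_inner_comm]
      ring
  have hi : Integrable fun y : V => Complex.exp (-(s : ℂ) * ‖y‖ ^ 2 + -Complex.I * inner ℝ ξ y) *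
        Complex.exp ((inner ℝ x ξ : ℝ) * Complex.I) :=
    (GaussianFourier.integrable_cexp_neg_mul_sq_norm_add (by simpa using hs) _ _).mul_const _
  rw [integral_complex_ofReal, integral_complex_ofReal, Complex.ofReal_inj] at h2
  rw [h2]
  have h3 := integral_re hi
  simp only [RCLike.re_to_complex] at h3
  rw [h3, integral_mul_const, h]
  have h4 : ((π : ℂ) / s) ^ (Module.finrank ℝ V / 2 : ℂ) =
      (((π / s) ^ (Module.finrank ℝ V / 2 : ℝ) : ℝ) : ℂ) := by
    rw [Complex.ofReal_cpow (by positivity)]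
    push_cast
    rfl
  have h5 : Complex.exp ((-Complex.I) ^ 2 * ‖ξ‖ ^ 2 / (4 * s)) =
      ((exp (-(‖ξ‖ ^ 2 / (4 * s))) : ℝ) : ℂ) := by
    push_cast
    congr 1
    rw [neg_sq, Complex.I_sq]
    ring
  rw [h4, h5, ← Complex.ofReal_mul, Complex.re_ofReal_mul, Complex.exp_ofReal_mul_I_re]

theorem integral_rpow_neg_mul_exp_neg_div_Ioi {a b : ℝ} (ha : 0 < a) (hb : 0 < b) :
    ∫ s in Set.Ioi (0 : ℝ), s ^ (-a - 1) * exp (-(b / s)) = b ^ (-a) * Gamma a := by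
  have h := integral_comp_rpow_Ioi (fun u : ℝ => u ^ (a - 1) * exp (-(b * u)))
    (p := -1) (by norm_num)
  rw [integral_rpow_mul_exp_neg_mul_Ioi ha hb, one_div, inv_rpow hb.le, ← rpow_neg hb.le] at h
  rw [← h]
  refine setIntegral_congr_fun measurableSet_Ioi fun s (hs : 0 < s) => ?_
  simp only [abs_neg, abs_one, one_mul, smul_eq_mul]
  rw [← mul_assoc, ← rpow_mul hs.le, ← rpow_add hs, rpow_neg_one, div_eq_mul_inv]
  ring_nf

theorem integrableOn_rpow_neg_mul_exp_neg_div_Ioi {a b : ℝ} (ha : 0 < a) (hb : 0 < b) :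
    IntegrableOn (fun s : ℝ => s ^ (-a - 1) * exp (-(b / s))) (Set.Ioi 0) := by
  by_contra hn
  have h := integral_rpow_neg_mul_exp_neg_div_Ioi ha hb
  rw [integral_undef hn] at h
  have : 0 < b ^ (-a) * Gamma a := mul_pos (by positivity) (Gamma_pos_of_pos ha)
  linarith

theorem integrableOn_rpow_mul_exp_neg_mul_Ioi {a r : ℝ} (ha : 0 < a) (hr : 0 < r) :
    IntegrableOn (fun s : ℝ => s ^ (a - 1) * exp (-(r * s))) (Set.Ioi 0) := by
  by_contra hn
  have h := integral_rpow_mul_exp_neg_mul_Ioi ha hr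
  rw [integral_undef hn] at h
  have : 0 < (1 / r) ^ a * Gamma a := mul_pos (by positivity) (Gamma_pos_of_pos ha)
  linarith

variable {N : ℕ}

theorem integral_fundSol_mul_exp_neg_mul_sq {s : ℝ} (hs : 0 < s)
    (x : EuclideanSpace ℝ (Fin N)) :
    ∫ y, fundSol N (x - y) 1 * exp (-s * ‖y‖ ^ 2) =
      ((2 * π) ^ N)⁻¹ * ((π / s) ^ (N / 2 : ℝ) *
        ∫ ξ : EuclideanSpace ℝ (Fin N), exp (-(‖ξ‖ ^ 2 / (4 * s))) *
          (exp (-1 * ‖ξ‖ ^ 4) * cos (inner ℝ x ξ))) := by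
  have hg : Integrable fun y : EuclideanSpace ℝ (Fin N) => exp (-s * ‖y‖ ^ 2) := by
    have h := GaussianFourier.integrable_cexp_neg_mul_sq_norm_add (V := EuclideanSpace ℝ (Fin N))
      (b := (s : ℂ)) (by simpa using hs) 0 0
    refine h.norm.congr (.of_forall fun y => ?_)
    simp [Complex.norm_exp, ← Complex.ofReal_pow]
  have hsym := integrable_exp_neg_mul_norm_pow_four (V := EuclideanSpace ℝ (Fin N)) one_pos
  have hprod : Integrable (Function.uncurry fun y ξ : EuclideanSpace ℝ (Fin N) =>
      exp (-s * ‖y‖ ^ 2) * (exp (-1 * ‖ξ‖ ^ 4) * cos (inner ℝ (x - y) ξ)))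
      (volume.prod volume) := by
    refine (hg.mul_prod hsym).mono' (Continuous.aestronglyMeasurable (by fun_prop))
      (.of_forall fun p => ?_)
    simp only [Function.uncurry, norm_mul, norm_eq_abs, abs_exp]
    gcongr
    exact mul_le_of_le_one_right (exp_pos _).le (abs_cos_le_one _)
  have h1 : ∀ y, fundSol N (x - y) 1 * exp (-s * ‖y‖ ^ 2) = ((2 * π) ^ N)⁻¹ *
      ∫ ξ : EuclideanSpace ℝ (Fin N),
        exp (-s * ‖y‖ ^ 2) * (exp (-1 * ‖ξ‖ ^ 4) * cos (inner ℝ (x - y) ξ)) := fun y => by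
    rw [fundSol, integral_const_mul]; ring
  simp only [h1]
  rw [integral_const_mul, integral_integral_swap hprod,
    ← integral_const_mul ((π / s) ^ (N / 2 : ℝ))]
  congr 1
  refine integral_congr_ae (.of_forall fun ξ => ?_)
  simp only
  have h2 := integral_exp_neg_mul_sq_mul_cos_inner hs x ξ
  rw [finrank_euclideanSpace_fin] at h2
  calc ∫ y, exp (-s * ‖y‖ ^ 2) * (exp (-1 * ‖ξ‖ ^ 4) * cos (inner ℝ (x - y) ξ))
      = exp (-1 * ‖ξ‖ ^ 4) * ∫ y, exp (-s * ‖y‖ ^ 2) * cos (inner ℝ (x - y) ξ) := by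
        rw [← integral_const_mul]
        refine integral_congr_ae (.of_forall fun y => ?_)
        simp only
        ring
    _ = _ := by rw [h2]; ring

/-- The frequency-side integral `∫ |ξ|^(β - N) exp(-|ξ|⁴) cos(x·ξ) dξ`, which is `S(1)|·|^(-β)` at
`x` up to a positive constant. -/
noncomputable def frequencyIntegral (N : ℕ) (β : ℝ) (x : EuclideanSpace ℝ (Fin N)) : ℝ :=
  ∫ ξ : EuclideanSpace ℝ (Fin N), ‖ξ‖ ^ (β - N) * (exp (-1 * ‖ξ‖ ^ 4) * cos (inner ℝ x ξ))

theorem integrable_norm_rpow_mul_exp [NeZero N] {β : ℝ} (h0 : 0 < β) (hβ : β ≤ N) :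
    Integrable fun ξ : EuclideanSpace ℝ (Fin N) => ‖ξ‖ ^ (β - N) * exp (-1 * ‖ξ‖ ^ 4) := by
  have h := (integrable_and_integral_mul_norm_rpow_neg_le (N := N) (γ := N - β) (Γ := N - β)
    (by linarith) le_rfl (by linarith) (integrable_exp_neg_mul_norm_pow_four one_pos)
    (fun y => (exp_pos _).le)
    (fun y => exp_le_one_iff.2 (by nlinarith [pow_nonneg (norm_nonneg y) 4])) 0).1
  refine h.congr (.of_forall fun ξ => ?_)
  simp only [zero_sub, norm_neg, neg_sub]
  ring

/-- The Fourier transform of `|·|^(-β)` is a multiple of `|·|^(β - N)`, tested against the kernel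
`G(x - ·, 1)`. Both powers are superpositions of Gaussians, which the Fourier transform
exchanges. -/
theorem Gamma_mul_powerEvolution_eq [NeZero N] {β : ℝ} (h0 : 0 < β) (hβ : β < N)
    (x : EuclideanSpace ℝ (Fin N)) :
    Gamma (β / 2) * powerEvolution N β 1 x =
      ((2 * π) ^ N)⁻¹ * (π ^ (N / 2 : ℝ) * (4 ^ ((N - β) / 2) * Gamma ((N - β) / 2))) *
        frequencyIntegral N β x := by
  have hb2 : 0 < β / 2 := by linarith
  have ha : 0 < (N - β) / 2 := by linarith
  have hne : ∀ᵐ y : EuclideanSpace ℝ (Fin N), y ≠ 0 := by simp [ae_iff, measure_singleton]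
  -- The Gaussian superposition `Γ(β/2) |y|^(-β) = ∫ s^(β/2 - 1) exp(-s|y|²) ds`.
  have hsup : ∀ y : EuclideanSpace ℝ (Fin N), y ≠ 0 →
      ∫ s in Set.Ioi (0 : ℝ), s ^ (β / 2 - 1) * exp (-(‖y‖ ^ 2 * s)) =
        Gamma (β / 2) * ‖y‖ ^ (-β) := fun y hy => by
    have hy0 : 0 < ‖y‖ := norm_pos_iff.2 hy
    rw [integral_rpow_mul_exp_neg_mul_Ioi hb2 (by positivity), one_div,
      inv_rpow (by positivity), ← rpow_natCast ‖y‖ 2, ← rpow_mul hy0.le, ← rpow_neg hy0.le,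
      mul_comm]
    congr 2
    push_cast
    ring
  have hF1 : Integrable (Function.uncurry fun (s : ℝ) (y : EuclideanSpace ℝ (Fin N)) =>
      fundSol N (x - y) 1 * (s ^ (β / 2 - 1) * exp (-(‖y‖ ^ 2 * s))))
      ((volume.restrict (Set.Ioi 0)).prod volume) := by
    have hm : AEStronglyMeasurable (Function.uncurry fun (s : ℝ) (y : EuclideanSpace ℝ (Fin N)) =>
        fundSol N (x - y) 1 * (s ^ (β / 2 - 1) * exp (-(‖y‖ ^ 2 * s))))
        ((volume.restrict (Set.Ioi 0)).prod volume) := by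
      have h1 : Measurable fun p : ℝ × EuclideanSpace ℝ (Fin N) => fundSol N (x - p.2) 1 :=
        ((continuous_fundSol one_pos).comp (by fun_prop)).measurable
      exact (h1.mul (by fun_prop)).aestronglyMeasurable
    refine (integrable_prod_iff' hm).2 ⟨?_, ?_⟩
    · filter_upwards [hne] with y hy
      have hy0 : 0 < ‖y‖ ^ 2 := by have := norm_pos_iff.2 hy; positivity
      simp only [Function.uncurry_apply_pair]
      exact (integrableOn_rpow_mul_exp_neg_mul_Ioi hb2 hy0).const_mul _
    · refine ((integrable_fundSol_mul_norm_rpow_neg one_pos h0.le hβ x).norm.const_mul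
        (Gamma (β / 2))).congr ?_
      filter_upwards [hne] with y hy
      simp only [Function.uncurry, norm_mul]
      rw [integral_const_mul, Real.norm_of_nonneg (by positivity : 0 ≤ ‖y‖ ^ (-β)),
        mul_left_comm, ← hsup y hy]
      congr 1
      refine setIntegral_congr_fun measurableSet_Ioi fun s (hs : 0 < s) => ?_
      rw [Real.norm_of_nonneg (by positivity), Real.norm_of_nonneg (by positivity)]
  -- The same superposition on the frequency side, after inverting `s`.
  have hsup' : ∀ ξ : EuclideanSpace ℝ (Fin N), ξ ≠ 0 →
      ∫ s in Set.Ioi (0 : ℝ), s ^ (-((N - β) / 2) - 1) * exp (-(‖ξ‖ ^ 2 / 4 / s)) =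
        4 ^ ((N - β) / 2) * Gamma ((N - β) / 2) * ‖ξ‖ ^ (β - N) := fun ξ hξ => by
    have hξ0 : 0 < ‖ξ‖ := norm_pos_iff.2 hξ
    rw [integral_rpow_neg_mul_exp_neg_div_Ioi ha (by positivity),
      div_rpow (by positivity) (by norm_num), ← rpow_natCast ‖ξ‖ 2, ← rpow_mul hξ0.le,
      rpow_neg (by norm_num : (0 : ℝ) ≤ 4), div_inv_eq_mul,
      show ((2 : ℕ) : ℝ) * -((N - β) / 2) = β - N by push_cast; ring]
    ring
  have hF3 : Integrable (Function.uncurry fun (s : ℝ) (ξ : EuclideanSpace ℝ (Fin N)) =>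
      s ^ (-((N - β) / 2) - 1) * exp (-(‖ξ‖ ^ 2 / 4 / s)) *
        (exp (-1 * ‖ξ‖ ^ 4) * cos (inner ℝ x ξ)))
      ((volume.restrict (Set.Ioi 0)).prod volume) := by
    have hm : AEStronglyMeasurable (Function.uncurry fun (s : ℝ) (ξ : EuclideanSpace ℝ (Fin N)) =>
        s ^ (-((N - β) / 2) - 1) * exp (-(‖ξ‖ ^ 2 / 4 / s)) *
          (exp (-1 * ‖ξ‖ ^ 4) * cos (inner ℝ x ξ)))
        ((volume.restrict (Set.Ioi 0)).prod volume) :=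
      Measurable.aestronglyMeasurable (by fun_prop)
    refine (integrable_prod_iff' hm).2 ⟨?_, ?_⟩
    · filter_upwards [hne] with ξ hξ
      have hξ0 : 0 < ‖ξ‖ ^ 2 / 4 := by have := norm_pos_iff.2 hξ; positivity
      simp only [Function.uncurry_apply_pair]
      exact (integrableOn_rpow_neg_mul_exp_neg_div_Ioi ha hξ0).mul_const _
    · have hi := (integrable_norm_rpow_mul_exp (N := N) h0 hβ.le).const_mul
        (4 ^ ((N - β) / 2) * Gamma ((N - β) / 2))
      refine hi.mono' hm.norm.prod_swap.integral_prod_right' ?_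
      filter_upwards [hne] with ξ hξ
      rw [Real.norm_of_nonneg (integral_nonneg fun s => norm_nonneg _)]
      simp only [Function.uncurry, norm_mul]
      simp only [integral_mul_const]
      rw [← mul_assoc (_ * _), ← hsup' ξ hξ]
      have he : ∫ s in Set.Ioi (0 : ℝ),
          ‖s ^ (-((N - β) / 2) - 1)‖ * ‖exp (-(‖ξ‖ ^ 2 / 4 / s))‖ =
          ∫ s in Set.Ioi (0 : ℝ), s ^ (-((N - β) / 2) - 1) * exp (-(‖ξ‖ ^ 2 / 4 / s)) := by
        refine setIntegral_congr_fun measurableSet_Ioi fun s (hs : 0 < s) => ?_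
        rw [Real.norm_of_nonneg (by positivity), Real.norm_of_nonneg (by positivity)]
      rw [he, norm_eq_abs, norm_eq_abs, abs_exp]
      refine mul_le_mul_of_nonneg_left
        (mul_le_of_le_one_right (exp_pos _).le (abs_cos_le_one _))
        (setIntegral_nonneg measurableSet_Ioi fun s (hs : 0 < s) => by positivity)
  calc Gamma (β / 2) * powerEvolution N β 1 x
      = ∫ y, ∫ s in Set.Ioi (0 : ℝ),
          fundSol N (x - y) 1 * (s ^ (β / 2 - 1) * exp (-(‖y‖ ^ 2 * s))) := by
        rw [powerEvolution, semigroup, ← integral_const_mul]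
        refine integral_congr_ae ?_
        filter_upwards [hne] with y hy
        rw [integral_const_mul, hsup y hy]
        ring
    _ = ∫ s in Set.Ioi (0 : ℝ), ∫ y,
          fundSol N (x - y) 1 * (s ^ (β / 2 - 1) * exp (-(‖y‖ ^ 2 * s))) :=
        (integral_integral_swap hF1).symm
    _ = ∫ s in Set.Ioi (0 : ℝ), ((2 * π) ^ N)⁻¹ * π ^ (N / 2 : ℝ) *
          ∫ ξ : EuclideanSpace ℝ (Fin N), s ^ (-((N - β) / 2) - 1) * exp (-(‖ξ‖ ^ 2 / 4 / s)) *
            (exp (-1 * ‖ξ‖ ^ 4) * cos (inner ℝ x ξ)) := by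
        refine setIntegral_congr_fun measurableSet_Ioi fun s (hs : 0 < s) => ?_
        have h1 := integral_fundSol_mul_exp_neg_mul_sq hs x
        have h2 : ∫ y, fundSol N (x - y) 1 * (s ^ (β / 2 - 1) * exp (-(‖y‖ ^ 2 * s))) =
            s ^ (β / 2 - 1) * ∫ y, fundSol N (x - y) 1 * exp (-s * ‖y‖ ^ 2) := by
          rw [← integral_const_mul]
          refine integral_congr_ae (.of_forall fun y => ?_)
          simp only
          rw [show -(‖y‖ ^ 2 * s) = -s * ‖y‖ ^ 2 by ring]
          ring
        have h3 : s ^ (-((N - β) / 2) - 1) = s ^ (β / 2 - 1) / s ^ (N / 2 : ℝ) := by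
          rw [← rpow_sub hs]; congr 1; ring
        rw [h2, h1, div_rpow pi_pos.le hs.le]
        simp only [mul_assoc, integral_const_mul, div_div]
        rw [h3]
        ring
    _ = ((2 * π) ^ N)⁻¹ * π ^ (N / 2 : ℝ) * ∫ ξ : EuclideanSpace ℝ (Fin N),
          ∫ s in Set.Ioi (0 : ℝ), s ^ (-((N - β) / 2) - 1) * exp (-(‖ξ‖ ^ 2 / 4 / s)) *
            (exp (-1 * ‖ξ‖ ^ 4) * cos (inner ℝ x ξ)) := by
        rw [integral_const_mul, integral_integral_swap hF3]
    _ = _ := by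
        rw [mul_assoc _ (π ^ (N / 2 : ℝ)), mul_assoc _ (π ^ (N / 2 : ℝ) * _),
          mul_assoc (π ^ (N / 2 : ℝ)), frequencyIntegral, ← integral_const_mul (4 ^ _ * _)]
        congr 2
        refine integral_congr_ae ?_
        filter_upwards [hne] with ξ hξ
        rw [integral_mul_const, hsup' ξ hξ]
        ring

theorem powerEvolution_one_pos_iff [NeZero N] {β : ℝ} (h0 : 0 < β) (hβ : β < N)
    (x : EuclideanSpace ℝ (Fin N)) :
    0 < powerEvolution N β 1 x ↔ 0 < frequencyIntegral N β x := by
  have h := Gamma_mul_powerEvolution_eq h0 hβ x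
  have h1 : 0 < Gamma (β / 2) := Gamma_pos_of_pos (by linarith)
  have h2 : 0 < Gamma ((N - β) / 2) := Gamma_pos_of_pos (by linarith)
  rw [← mul_pos_iff_of_pos_left h1, h, mul_pos_iff_of_pos_left (by positivity)]

/-! ### Polar coordinates, and positivity for small exponents -/

theorem integrableOn_rpow_mul_exp_neg_pow_four {a : ℝ} (ha : -1 < a) :
    IntegrableOn (fun s : ℝ => s ^ a * exp (-1 * s ^ 4)) (Set.Ioi 0) := by
  refine (integrableOn_rpow_mul_exp_neg_rpow (p := 4) ha (by norm_num)).congr_fun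
    (fun s hs => ?_) measurableSet_Ioi
  simp only
  rw [neg_one_mul]
  norm_cast

open Filter Topology Set in
/-- If the primitive of `f` is nonnegative, then `f` has positive integral against every weight
`s ^ (β - 1 - p) exp(-s⁴)` that decreases: integrate by parts to move the derivative onto the
weight. The bound `|f s| ≤ C s ^ p` controls the boundary term at the origin. -/
theorem integral_rpow_mul_exp_mul_pos {p β C : ℝ} (hp : -1 < p) (h0 : 0 < β) (hβ : β ≤ 1 + p)
    {f : ℝ → ℝ} (hf : ContinuousOn f (Ioi 0)) (hC : ∀ s, 0 < s → |f s| ≤ C * s ^ p)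
    (hW : ∀ R, 0 < R → 0 ≤ ∫ s in 0..R, f s) (hW0 : ∃ R, 0 < R ∧ 0 < ∫ s in 0..R, f s) :
    0 < ∫ s in Ioi (0 : ℝ), s ^ (β - 1 - p) * exp (-1 * s ^ 4) * f s := by
  set W : ℝ → ℝ := fun R => ∫ s in 0..R, f s with hWdef
  have hC0 : 0 ≤ C := by simpa using (abs_nonneg _).trans (hC 1 one_pos)
  have hfi : ∀ R, 0 < R → IntervalIntegrable f volume 0 R := fun R hR => by
    have h1 : IntervalIntegrable (fun s : ℝ => C * s ^ p) volume 0 R :=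
      (intervalIntegral.intervalIntegrable_rpow' hp).const_mul C
    rw [intervalIntegrable_iff_integrableOn_Ioc_of_le hR.le] at h1 ⊢
    refine h1.mono' ((hf.mono Ioc_subset_Ioi_self).aestronglyMeasurable measurableSet_Ioc) ?_
    filter_upwards [ae_restrict_mem measurableSet_Ioc] with s hs
    exact hC s hs.1
  have hWd : ∀ s ∈ Ioi (0 : ℝ), HasDerivAt W (f s) s := fun s hs =>
    intervalIntegral.integral_hasDerivAt_right (hfi s hs)
      (hf.stronglyMeasurableAtFilter isOpen_Ioi s hs) (hf.continuousAt (Ioi_mem_nhds hs))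
  have hWb : ∀ s, 0 < s → |W s| ≤ C / (p + 1) * s ^ (p + 1) := fun s hs => by
    have h1 : ∫ u in 0..s, C * u ^ p = C / (p + 1) * s ^ (p + 1) := by
      rw [intervalIntegral.integral_const_mul, integral_rpow (.inl hp),
        zero_rpow (by linarith)]
      ring
    rw [← h1, ← Real.norm_eq_abs]
    refine intervalIntegral.norm_integral_le_of_norm_le hs.le
      (.of_forall fun u hu => hC u hu.1)
      ((intervalIntegral.intervalIntegrable_rpow' hp).const_mul C)
  set D : ℝ → ℝ := fun s => s ^ (β - 1 - p) * exp (-1 * s ^ 4) with hD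
  set D' : ℝ → ℝ := fun s => -(((1 + p - β) * s ^ (β - 2 - p) + 4 * s ^ (β + 2 - p)) *
    exp (-1 * s ^ 4)) with hD'
  have hDd : ∀ s ∈ Ioi (0 : ℝ), HasDerivAt D (D' s) s := fun s (hs : 0 < s) => by
    have h1 := Real.hasDerivAt_rpow_const (x := s) (p := β - 1 - p) (.inl hs.ne')
    have h2 : HasDerivAt (fun s : ℝ => exp (-1 * s ^ 4))
        (exp (-1 * s ^ 4) * (-1 * (4 * s ^ 3))) s := by
      have := ((hasDerivAt_pow 4 s).const_mul (-1 : ℝ)).exp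
      simpa using this
    refine (h1.mul h2).congr_deriv ?_
    have h3 : s ^ (β + 2 - p) = s ^ (β - 1 - p) * s ^ 3 := by
      rw [← rpow_natCast, ← rpow_add hs]; congr 1; push_cast; ring
    simp only [hD']
    rw [h3, show β - 1 - p - 1 = β - 2 - p by ring]
    ring
  have hDfi : IntegrableOn (D * f) (Ioi 0) := by
    refine Integrable.mono'
      ((integrableOn_rpow_mul_exp_neg_pow_four (a := β - 1) (by linarith)).const_mul C)
      (ContinuousOn.aestronglyMeasurable ?_ measurableSet_Ioi) ?_
    · exact ContinuousOn.mul (fun s hs => (hDd s hs).continuousAt.continuousWithinAt) hf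
    · filter_upwards [ae_restrict_mem measurableSet_Ioi] with s (hs : 0 < s)
      have hsp : s ^ (β - 1) = s ^ (β - 1 - p) * s ^ p := by rw [← rpow_add hs]; congr 1; ring
      rw [Pi.mul_apply, norm_mul, Real.norm_of_nonneg (by positivity : 0 ≤ D s), hsp, norm_eq_abs]
      calc D s * |f s| ≤ D s * (C * s ^ p) := by gcongr; exact hC s hs
        _ = _ := by simp only [hD]; ring
  have hDWi : IntegrableOn (D' * W) (Ioi 0) := by
    refine Integrable.mono'
      (((integrableOn_rpow_mul_exp_neg_pow_four (a := β - 1) (by linarith)).const_mul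
      ((1 + p - β) * (C / (p + 1)))).add
      ((integrableOn_rpow_mul_exp_neg_pow_four (a := β + 3) (by linarith)).const_mul
      (4 * (C / (p + 1))))) (ContinuousOn.aestronglyMeasurable ?_ measurableSet_Ioi) ?_
    · refine ContinuousOn.mul (ContinuousOn.neg (ContinuousOn.mul (ContinuousOn.add ?_ ?_)
        (by fun_prop))) (fun s hs => (hWd s hs).continuousAt.continuousWithinAt)
      · exact continuousOn_const.mul
          (continuousOn_id.rpow_const fun s (hs : 0 < s) => .inl hs.ne')
      · exact continuousOn_const.mul
          (continuousOn_id.rpow_const fun s (hs : 0 < s) => .inl hs.ne')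
    · filter_upwards [ae_restrict_mem measurableSet_Ioi] with s (hs : 0 < s)
      have h1 : s ^ (β - 1) = s ^ (β - 2 - p) * s ^ (p + 1) := by
        rw [← rpow_add hs]; congr 1; ring
      have h2 : s ^ (β + 3) = s ^ (β + 2 - p) * s ^ (p + 1) := by
        rw [← rpow_add hs]; congr 1; ring
      have h3 : 0 ≤ 1 + p - β := by linarith
      simp only [Pi.mul_apply, Pi.add_apply, norm_mul, hD', norm_neg]
      rw [Real.norm_of_nonneg (by positivity : 0 ≤ (1 + p - β) * s ^ (β - 2 - p) +
        4 * s ^ (β + 2 - p)), Real.norm_of_nonneg (exp_pos _).le, norm_eq_abs, h1, h2]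
      calc ((1 + p - β) * s ^ (β - 2 - p) + 4 * s ^ (β + 2 - p)) * exp (-1 * s ^ 4) * |W s|
          ≤ ((1 + p - β) * s ^ (β - 2 - p) + 4 * s ^ (β + 2 - p)) * exp (-1 * s ^ 4) *
            (C / (p + 1) * s ^ (p + 1)) := by gcongr; exact hWb s hs
        _ = _ := by ring
  have hDWb : ∀ s, 0 < s → ‖(D * W) s‖ ≤ C / (p + 1) * (s ^ β * exp (-1 * s ^ 4)) := fun s hs => by
    have h1 : s ^ β = s ^ (β - 1 - p) * s ^ (p + 1) := by rw [← rpow_add hs]; congr 1; ring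
    rw [Pi.mul_apply, norm_mul, Real.norm_of_nonneg (by positivity : 0 ≤ D s), norm_eq_abs, h1]
    calc D s * |W s| ≤ D s * (C / (p + 1) * s ^ (p + 1)) := by gcongr; exact hWb s hs
      _ = _ := by simp only [hD]; ring
  have hlim0 : Tendsto (D * W) (𝓝[>] 0) (𝓝 0) := by
    refine squeeze_zero_norm' (eventually_mem_nhdsWithin.mono fun s hs => hDWb s hs) ?_
    have h : ContinuousAt (fun s : ℝ => C / (p + 1) * (s ^ β * exp (-1 * s ^ 4))) 0 :=
      continuousAt_const.mul ((continuousAt_id.rpow_const (.inr h0.le)).mul (by fun_prop))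
    have h' := h.tendsto.mono_left (nhdsWithin_le_nhds (s := Ioi 0))
    simpa [zero_rpow h0.ne'] using h'
  have hlim1 : Tendsto (D * W) atTop (𝓝 0) := by
    refine squeeze_zero_norm' ((eventually_gt_atTop 0).mono fun s hs => hDWb s hs) ?_
    have h1 := (tendsto_rpow_mul_exp_neg_mul_atTop_nhds_zero β 1 one_pos).const_mul (C / (p + 1))
    rw [mul_zero] at h1
    refine squeeze_zero' ?_ ?_ h1
    · filter_upwards [eventually_gt_atTop 0] with s hs
      have : 0 < p + 1 := by linarith
      positivity
    · filter_upwards [eventually_ge_atTop 1] with s hs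
      have : 0 < p + 1 := by linarith
      have : s ≤ s ^ 4 := le_self_pow₀ hs (by norm_num)
      have : exp (-1 * s ^ 4) ≤ exp (-1 * s) := exp_le_exp.2 (by linarith)
      have : 0 ≤ s ^ β := by positivity
      gcongr
  have hparts := integral_Ioi_mul_deriv_eq_deriv_mul hDd hWd hDfi hDWi hlim0 hlim1
  have hE : ∀ s, 0 < s → D' s < 0 := fun s hs => by
    have h3 : 0 ≤ 1 + p - β := by linarith
    simp only [hD']
    have : 0 < ((1 + p - β) * s ^ (β - 2 - p) + 4 * s ^ (β + 2 - p)) * exp (-1 * s ^ 4) := by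
      positivity
    linarith
  rw [hparts, sub_zero, zero_sub, ← integral_neg]
  rw [setIntegral_pos_iff_support_of_nonneg_ae]
  · obtain ⟨R, hR, hWR⟩ := hW0
    have hWc : ContinuousOn W (Ioi 0) := fun s hs => (hWd s hs).continuousAt.continuousWithinAt
    have hopen : IsOpen (Ioi 0 ∩ W ⁻¹' (Ioi 0)) := hWc.isOpen_inter_preimage isOpen_Ioi isOpen_Ioi
    refine (hopen.measure_pos volume ⟨R, hR, hWR⟩).trans_le (measure_mono fun s hs => ⟨?_, hs.1⟩)
    exact neg_ne_zero.2 (mul_ne_zero (hE s hs.1).ne (ne_of_gt hs.2))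
  · filter_upwards [ae_restrict_mem measurableSet_Ioi] with s hs
    have := mul_nonneg (neg_pos.2 (hE s hs)).le (hW s hs)
    simpa using this
  · exact hDWi.neg

/-- The generalised Fresnel integral `∫₀ᴿ s ^ (-9/20) cos s ds` is positive for every `R > 0`: the
quarter period `[0, π/2]` outweighs everything after it, because `s ^ (-9/20) (1 + sin s)` has
derivative at most `s ^ (-9/20) cos s`. -/
theorem integral_rpow_mul_cos_pos {R : ℝ} (hR : 0 < R) :
    0 < ∫ s in 0..R, s ^ (-(9 / 20) : ℝ) * cos s := by
  have hii : ∀ a b : ℝ, IntervalIntegrable (fun s : ℝ => s ^ (-(9 / 20) : ℝ) * cos s) volume a b :=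
    fun a b => (intervalIntegral.intervalIntegrable_rpow' (by norm_num)).mul_continuousOn
      (by fun_prop)
  rcases le_or_gt R (π / 2) with h | h
  · refine intervalIntegral.intervalIntegral_pos_of_pos_on (hii 0 R) (fun s hs => ?_) hR
    exact mul_pos (rpow_pos_of_pos hs.1 _)
      (cos_pos_of_mem_Ioo ⟨by linarith [hs.1, pi_pos], by linarith [hs.2]⟩)
  set b := π / 2 with hb
  have hb0 : 0 < b := by positivity
  have h1 : (b ^ (11 / 20 : ℝ)) * (20 / 11) - b ^ (51 / 20 : ℝ) * (10 / 51) ≤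
      ∫ s in 0..b, s ^ (-(9 / 20) : ℝ) * cos s := by
    have hi1 : IntervalIntegrable (fun s : ℝ => s ^ (-(9 / 20) : ℝ)) volume 0 b :=
      intervalIntegral.intervalIntegrable_rpow' (by norm_num)
    have hi2 : IntervalIntegrable (fun s : ℝ => s ^ (31 / 20 : ℝ)) volume 0 b :=
      intervalIntegral.intervalIntegrable_rpow' (by norm_num)
    have he : ∫ s in 0..b, (s ^ (-(9 / 20) : ℝ) - (1 / 2) * s ^ (31 / 20 : ℝ)) =
        (b ^ (11 / 20 : ℝ)) * (20 / 11) - b ^ (51 / 20 : ℝ) * (10 / 51) := by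
      rw [intervalIntegral.integral_sub hi1 (hi2.const_mul _), intervalIntegral.integral_const_mul,
        integral_rpow (.inl (by norm_num)), integral_rpow (.inl (by norm_num)),
        zero_rpow (by norm_num), zero_rpow (by norm_num)]
      norm_num
      ring
    rw [← he]
    refine intervalIntegral.integral_mono_on_of_le_Ioo hb0.le (hi1.sub (hi2.const_mul _))
      (hii 0 b) fun s hs => ?_
    have h2 := one_sub_sq_div_two_le_cos (x := s)
    have h3 : s ^ (31 / 20 : ℝ) = s ^ (-(9 / 20) : ℝ) * s ^ 2 := by
      rw [← rpow_natCast, ← rpow_add hs.1]; norm_num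
    have h4 : 0 < s ^ (-(9 / 20) : ℝ) := rpow_pos_of_pos hs.1 _
    rw [h3]
    nlinarith
  have h2 : -(2 * b ^ (-(9 / 20) : ℝ)) ≤ ∫ s in b..R, s ^ (-(9 / 20) : ℝ) * cos s := by
    set Ψ : ℝ → ℝ := fun s => s ^ (-(9 / 20) : ℝ) * (sin s + 1) with hΨ
    have hd : ∀ s, 0 < s → HasDerivAt Ψ (-(9 / 20) * s ^ (-(9 / 20) - 1 : ℝ) * (sin s + 1) +
        s ^ (-(9 / 20) : ℝ) * cos s) s := fun s hs =>
      (Real.hasDerivAt_rpow_const (.inl hs.ne')).mul ((hasDerivAt_sin s).add_const 1)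
    have h3 := intervalIntegral.sub_le_integral_of_hasDeriv_right_of_le (g := Ψ)
      (φ := fun s => s ^ (-(9 / 20) : ℝ) * cos s) h.le
      (fun s hs => (hd s (hb0.trans_le hs.1)).continuousAt.continuousWithinAt)
      (fun s hs => (hd s (hb0.trans hs.1)).hasDerivWithinAt)
      ((intervalIntegrable_iff_integrableOn_Icc_of_le h.le).1 (hii b R))
      (fun s hs => by
        have : 0 < s := hb0.trans hs.1
        have h4 : 0 ≤ s ^ (-(9 / 20) - 1 : ℝ) * (sin s + 1) :=
          mul_nonneg (by positivity) (by linarith [neg_one_le_sin s])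
        linarith)
    have h5 : 0 ≤ Ψ R := mul_nonneg (by positivity) (by linarith [neg_one_le_sin R])
    have h6 : Ψ b = 2 * b ^ (-(9 / 20) : ℝ) := by
      simp only [hΨ, hb, sin_pi_div_two]; ring
    linarith
  rw [← intervalIntegral.integral_add_adjacent_intervals (hii 0 b) (hii b R)]
  have h7 : b ^ (11 / 20 : ℝ) = b ^ (-(9 / 20) : ℝ) * b := by
    rw [← rpow_add_one hb0.ne']; norm_num
  have h8 : b ^ (51 / 20 : ℝ) = b ^ (-(9 / 20) : ℝ) * b ^ 3 := by
    rw [← rpow_natCast, ← rpow_add hb0]; norm_num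
  have h9 : 0 < b ^ (-(9 / 20) : ℝ) := by positivity
  -- With `b = π/2` the two bounds combine to `(20/11) b - (10/51) b³ > 2`.
  have hlo : 1.57 ≤ b := by rw [hb]; linarith [pi_gt_d2]
  have hhi : b ≤ 1.5708 := by rw [hb]; linarith [pi_lt_d4]
  have h10 : 0 < b * (20 / 11) - b ^ 3 * (10 / 51) - 2 := by
    have : b ^ 3 ≤ 1.5708 ^ 3 := by gcongr
    norm_num at this
    linarith
  have h11 := mul_pos h9 h10
  rw [h7, h8] at h1
  linarith

theorem integral_rpow_mul_cos_mul_pos (ρ : ℝ) {R : ℝ} (hR : 0 < R) :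
    0 < ∫ s in 0..R, s ^ (-(9 / 20) : ℝ) * cos (ρ * s) := by
  have key : ∀ r : ℝ, 0 < r → 0 < ∫ s in 0..R, s ^ (-(9 / 20) : ℝ) * cos (r * s) := fun r hr => by
    have h1 : ∫ s in 0..R, s ^ (-(9 / 20) : ℝ) * cos (r * s) =
        ∫ s in 0..R, r ^ (9 / 20 : ℝ) * ((r * s) ^ (-(9 / 20) : ℝ) * cos (r * s)) := by
      refine intervalIntegral.integral_congr fun s hs => ?_
      rw [Set.uIcc_of_le hR.le] at hs
      rw [mul_rpow hr.le hs.1, rpow_neg hr.le, ← mul_assoc, mul_inv_cancel_left₀ (by positivity)]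
    rw [h1, intervalIntegral.integral_const_mul, intervalIntegral.integral_comp_mul_left
      (fun u => u ^ (-(9 / 20) : ℝ) * cos u) hr.ne', mul_zero, smul_eq_mul]
    have := integral_rpow_mul_cos_pos (mul_pos hr hR)
    positivity
  rcases lt_trichotomy ρ 0 with h | h | h
  · have := key (-ρ) (by linarith)
    simpa only [neg_mul, cos_neg] using this
  · subst h
    simp only [zero_mul, cos_zero, mul_one]
    refine intervalIntegral.intervalIntegral_pos_of_pos_on
      (intervalIntegral.intervalIntegrable_rpow' (by norm_num)) (fun s hs => ?_) hR
    exact rpow_pos_of_pos hs.1 _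
  · exact key ρ h

theorem integral_rpow_mul_exp_mul_cos_pos {β : ℝ} (h0 : 0 < β) (hβ : β ≤ 11 / 20) (ρ : ℝ) :
    0 < ∫ s in Set.Ioi (0 : ℝ), s ^ (β - 1) * exp (-1 * s ^ 4) * cos (ρ * s) := by
  have h := integral_rpow_mul_exp_mul_pos (p := -(9 / 20)) (C := 1) (by norm_num) h0 (by linarith)
    (f := fun s => s ^ (-(9 / 20) : ℝ) * cos (ρ * s))
    (ContinuousOn.mul (continuousOn_id.rpow_const fun s hs => .inl (ne_of_gt hs)) (by fun_prop))
    (fun s hs => by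
      have h1 : 0 < s ^ (-(9 / 20) : ℝ) := rpow_pos_of_pos hs _
      rw [abs_mul, abs_of_pos h1, one_mul]
      exact mul_le_of_le_one_right h1.le (abs_cos_le_one _))
    (fun R hR => (integral_rpow_mul_cos_mul_pos ρ hR).le)
    ⟨1, one_pos, integral_rpow_mul_cos_mul_pos ρ one_pos⟩
  refine h.trans_eq (setIntegral_congr_fun measurableSet_Ioi fun s (hs : 0 < s) => ?_)
  have h1 : s ^ (β - 1) = s ^ (β - 1 - -(9 / 20)) * s ^ (-(9 / 20) : ℝ) := by
    rw [← rpow_add hs]; congr 1; ring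
  rw [h1]
  ring

section polar

variable {V : Type*} [NormedAddCommGroup V] [NormedSpace ℝ V] [FiniteDimensional ℝ V]
  [MeasurableSpace V] [BorelSpace V] [Nontrivial V] (μ : Measure V) [μ.IsAddHaarMeasure]

open Set Metric in
/-- Polar coordinates for a function that need not be radial. -/
theorem integral_eq_integral_toSphere_Ioi {F : V → ℝ} (hF : Integrable F μ) :
    ∫ x, F x ∂μ = ∫ ω : sphere (0 : V) 1, ∫ s in Ioi (0 : ℝ),
      s ^ (Module.finrank ℝ V - 1) * F (s • (ω : V)) ∂volume ∂μ.toSphere := by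
  set n := Module.finrank ℝ V - 1 with hn
  set g : sphere (0 : V) 1 × Ioi (0 : ℝ) → ℝ := fun p => F ((p.2 : ℝ) • (p.1 : V)) with hg
  have hcomp : ∀ x : ({0}ᶜ : Set V), g (homeomorphUnitSphereProd V x) = F x := fun x => by
    have hx : ‖(x : V)‖ ≠ 0 := norm_ne_zero_iff.2 x.2
    simp only [hg, homeomorphUnitSphereProd_apply_snd_coe, homeomorphUnitSphereProd_apply_fst_coe]
    rw [smul_smul, mul_inv_cancel₀ hx, one_smul]
  have hmp := μ.measurePreserving_homeomorphUnitSphereProd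
  have hemb := (homeomorphUnitSphereProd V).measurableEmbedding
  have hgi : Integrable g (μ.toSphere.prod (Measure.volumeIoiPow n)) := by
    rw [← hmp.integrable_comp_emb hemb]
    have h1 : (g ∘ homeomorphUnitSphereProd V) = F ∘ ((↑) : ({0}ᶜ : Set V) → V) := funext hcomp
    rw [h1, ← integrableOn_iff_comap_subtypeVal (measurableSet_singleton _).compl]
    exact hF.integrableOn
  have h2 : ∫ x, F x ∂μ = ∫ p, g p ∂(μ.toSphere.prod (Measure.volumeIoiPow n)) := by
    rw [← hmp.integral_comp hemb]
    simp only [hcomp]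
    rw [integral_subtype_comap (measurableSet_singleton _).compl fun x => F x,
      restrict_compl_singleton]
  rw [h2, integral_prod g hgi]
  refine integral_congr_ae (.of_forall fun ω => ?_)
  simp only [Measure.volumeIoiPow, ENNReal.ofReal]
  rw [integral_withDensity_eq_integral_smul (by fun_prop),
    integral_subtype_comap measurableSet_Ioi fun a : ℝ => Real.toNNReal (a ^ n) • F (a • (ω : V))]
  refine setIntegral_congr_fun measurableSet_Ioi fun s hs => ?_
  rw [NNReal.smul_def, Real.coe_toNNReal _ (pow_nonneg (le_of_lt hs) _), smul_eq_mul]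

end polar

theorem frequencyIntegral_eq_integral_toSphere {N : ℕ} [NeZero N] {β : ℝ} (h0 : 0 < β)
    (hβ : β ≤ N) (x : EuclideanSpace ℝ (Fin N)) :
    frequencyIntegral N β x =
      ∫ ω : Metric.sphere (0 : EuclideanSpace ℝ (Fin N)) 1, ∫ s in Set.Ioi (0 : ℝ),
        s ^ (β - 1) * exp (-1 * s ^ 4) * cos (inner ℝ x (ω : EuclideanSpace ℝ (Fin N)) * s)
        ∂volume ∂(volume : Measure (EuclideanSpace ℝ (Fin N))).toSphere := by
  have hN : 1 ≤ N := NeZero.one_le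
  have hi : Integrable fun ξ : EuclideanSpace ℝ (Fin N) =>
      ‖ξ‖ ^ (β - N) * (exp (-1 * ‖ξ‖ ^ 4) * cos (inner ℝ x ξ)) := by
    simp only [← mul_assoc]
    exact (integrable_norm_rpow_mul_exp h0 hβ).mul_bdd (c := 1) (by fun_prop)
      (.of_forall fun ξ => by simpa using abs_cos_le_one _)
  rw [frequencyIntegral, integral_eq_integral_toSphere_Ioi volume hi]
  refine integral_congr_ae (.of_forall fun ω => ?_)
  refine setIntegral_congr_fun measurableSet_Ioi fun s (hs : 0 < s) => ?_
  have hω : ‖(ω : EuclideanSpace ℝ (Fin N))‖ = 1 := norm_eq_of_mem_sphere ω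
  have h1 : s ^ (β - 1) = s ^ (N - 1) * s ^ (β - N) := by
    rw [← rpow_natCast, ← rpow_add hs, Nat.cast_sub hN]; congr 1; push_cast; ring
  simp only [norm_smul, inner_smul_right, hω, mul_one, Real.norm_of_nonneg hs.le,
    finrank_euclideanSpace_fin]
  rw [h1, mul_comm (inner ℝ x _) s]
  ring

/-- Positivity holds already along each direction of the sphere, without averaging. -/
theorem frequencyIntegral_pos_of_le_eleven_div_twenty {N : ℕ} [NeZero N] {β : ℝ} (h0 : 0 < β)
    (hβ : β ≤ 11 / 20) (x : EuclideanSpace ℝ (Fin N)) : 0 < frequencyIntegral N β x := by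
  have hN : (1 : ℝ) ≤ N := by exact_mod_cast (NeZero.one_le : 1 ≤ N)
  rw [frequencyIntegral_eq_integral_toSphere h0 (by linarith)]
  have hexp : IntegrableOn (fun s : ℝ => s ^ (β - 1) * exp (-1 * s ^ 4)) (Set.Ioi 0) :=
    integrableOn_rpow_mul_exp_neg_pow_four (by linarith)
  have hc : Continuous fun ρ : ℝ =>
      ∫ s in Set.Ioi (0 : ℝ), s ^ (β - 1) * exp (-1 * s ^ 4) * cos (ρ * s) := by
    refine continuous_of_dominated (bound := fun s => s ^ (β - 1) * exp (-1 * s ^ 4))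
      (fun ρ => Measurable.aestronglyMeasurable (by fun_prop)) (fun ρ => ?_) hexp
      (.of_forall fun s => by fun_prop)
    filter_upwards [ae_restrict_mem measurableSet_Ioi] with s (hs : 0 < s)
    have h1 : 0 ≤ s ^ (β - 1) * exp (-1 * s ^ 4) := by positivity
    rw [norm_mul, Real.norm_of_nonneg h1]
    exact mul_le_of_le_one_right h1 (abs_cos_le_one _)
  have hcω : Continuous fun ω : Metric.sphere (0 : EuclideanSpace ℝ (Fin N)) 1 =>
      ∫ s in Set.Ioi (0 : ℝ), s ^ (β - 1) * exp (-1 * s ^ 4) *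
        cos (inner ℝ x (ω : EuclideanSpace ℝ (Fin N)) * s) :=
    hc.comp (by fun_prop : Continuous fun ω : Metric.sphere (0 : EuclideanSpace ℝ (Fin N)) 1 =>
      inner ℝ x (ω : EuclideanSpace ℝ (Fin N)))
  have hpos : ∀ ω : Metric.sphere (0 : EuclideanSpace ℝ (Fin N)) 1,
      0 < ∫ s in Set.Ioi (0 : ℝ), s ^ (β - 1) * exp (-1 * s ^ 4) *
        cos (inner ℝ x (ω : EuclideanSpace ℝ (Fin N)) * s) :=
    fun ω => integral_rpow_mul_exp_mul_cos_pos h0 hβ _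
  rw [integral_pos_iff_support_of_nonneg (fun ω => (hpos ω).le)
    (hcω.integrable_of_hasCompactSupport (.of_compactSpace _)),
    Set.eq_univ_of_forall (s := Function.support _) fun ω => (hpos ω).ne',
    Measure.measure_univ_pos]
  exact Measure.toSphere_ne_zero _

/-! ### A Sturm comparison argument -/

section sturm

open Set Filter Topology

theorem exists_first_zero {f : ℝ → ℝ} {a b : ℝ} (hab : a ≤ b) (hf : ContinuousOn f (Icc a b))
    (ha : 0 < f a) (hb : f b ≤ 0) : ∃ c ∈ Ioc a b, f c = 0 ∧ ∀ s ∈ Ico a c, 0 < f s := by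
  set S := Icc a b ∩ f ⁻¹' Iic 0 with hS
  have hcl : IsClosed S := hf.preimage_isClosed_of_isClosed isClosed_Icc isClosed_Iic
  have hne : S.Nonempty := ⟨b, ⟨hab, le_rfl⟩, hb⟩
  have hbd : BddBelow S := ⟨a, fun s hs => hs.1.1⟩
  have hmem : sInf S ∈ S := hcl.csInf_mem hne hbd
  have hlt : ∀ s ∈ Ico a (sInf S), 0 < f s := fun s hs => by
    by_contra hn
    exact absurd (csInf_le hbd (⟨⟨hs.1, hs.2.le.trans hmem.1.2⟩, not_lt.1 hn⟩ : s ∈ S))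
      (not_le.2 hs.2)
  have hac : a < sInf S := lt_of_le_of_ne hmem.1.1 fun h => by
    have : f (sInf S) ≤ 0 := hmem.2
    rw [← h] at this
    linarith
  refine ⟨sInf S, ⟨hac, hmem.1.2⟩, ?_, hlt⟩
  obtain ⟨d, hd, hd0⟩ := intermediate_value_Icc' hac.le
    (hf.mono (Icc_subset_Icc_right hmem.1.2)) (⟨hmem.2, ha.le⟩ : (0 : ℝ) ∈ Icc (f (sInf S)) (f a))
  rcases hd.2.lt_or_eq with h | h
  · exact absurd (hlt d ⟨hd.1, h⟩) (by rw [hd0]; exact lt_irrefl 0)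
  · rw [← h, hd0]

theorem eventually_lt_of_hasDerivAt_pos {f : ℝ → ℝ} {d x : ℝ} (h : HasDerivAt f d x)
    (hd : 0 < d) : (∀ᶠ s in 𝓝[>] x, f x < f s) ∧ ∀ᶠ s in 𝓝[<] x, f s < f x := by
  have h1 := (hasDerivAt_iff_tendsto_slope.1 h).eventually (lt_mem_nhds hd)
  constructor
  · filter_upwards [h1.filter_mono (nhdsWithin_mono x fun s hs => ne_of_gt hs),
      self_mem_nhdsWithin] with s hs (hxs : x < s)
    exact slope_pos_iff_of_le hxs.le |>.1 hs
  · filter_upwards [h1.filter_mono (nhdsWithin_mono x fun s hs => ne_of_lt hs),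
      self_mem_nhdsWithin] with s hs (hxs : s < x)
    rw [slope_comm] at hs
    exact slope_pos_iff_of_le hxs.le |>.1 hs

/-- A maximum principle: a subsolution of `w'' = k² w` with `w(0) = 0` and `w'(0) ≤ 0` is
nonpositive. -/
theorem nonpos_of_deriv_deriv_le {w w' w'' : ℝ → ℝ} {k L : ℝ}
    (hw : ∀ s ∈ Icc 0 L, HasDerivAt w (w' s) s) (hw' : ∀ s ∈ Icc 0 L, HasDerivAt w' (w'' s) s)
    (hle : ∀ s ∈ Ioo 0 L, w'' s ≤ k ^ 2 * w s) (h0 : w 0 = 0) (h0' : w' 0 ≤ 0) :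
    ∀ s ∈ Icc 0 L, w s ≤ 0 := by
  have hexp : ∀ c s : ℝ, HasDerivAt (fun s : ℝ => exp (c * s)) (exp (c * s) * c) s := fun c s => by
    simpa using ((hasDerivAt_id s).const_mul c).exp
  -- `w'' - k² w` factors as `(∂ + k)(∂ - k) w`; integrate the two first-order inequalities.
  have h1 : AntitoneOn (fun s => exp (k * s) * (w' s - k * w s)) (Icc 0 L) := by
    have hd : ∀ s ∈ Icc 0 L, HasDerivAt (fun s => exp (k * s) * (w' s - k * w s))
        (exp (k * s) * k * (w' s - k * w s) + exp (k * s) * (w'' s - k * w' s)) s :=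
      fun s hs => (hexp k s).mul ((hw' s hs).sub ((hw s hs).const_mul k))
    refine antitoneOn_of_deriv_nonpos (convex_Icc 0 L)
      (fun s hs => (hd s hs).continuousAt.continuousWithinAt)
      (fun s hs => (hd s (interior_subset hs)).differentiableAt.differentiableWithinAt)
      fun s hs => ?_
    rw [(hd s (interior_subset hs)).deriv]
    rw [interior_Icc] at hs
    have := hle s hs
    have := exp_pos (k * s)
    nlinarith
  have h2 : ∀ s ∈ Icc 0 L, w' s - k * w s ≤ 0 := fun s hs => by
    have h := h1 ⟨le_rfl, hs.1.trans hs.2⟩ hs hs.1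
    simp only [mul_zero, exp_zero, one_mul, h0, sub_zero] at h
    exact nonpos_of_mul_nonpos_right (h.trans h0') (exp_pos _)
  have h3 : AntitoneOn (fun s => exp (-k * s) * w s) (Icc 0 L) := by
    have hd : ∀ s ∈ Icc 0 L, HasDerivAt (fun s => exp (-k * s) * w s)
        (exp (-k * s) * -k * w s + exp (-k * s) * w' s) s :=
      fun s hs => (hexp (-k) s).mul (hw s hs)
    refine antitoneOn_of_deriv_nonpos (convex_Icc 0 L)
      (fun s hs => (hd s hs).continuousAt.continuousWithinAt)
      (fun s hs => (hd s (interior_subset hs)).differentiableAt.differentiableWithinAt)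
      fun s hs => ?_
    rw [(hd s (interior_subset hs)).deriv]
    have := h2 s (interior_subset hs)
    have := exp_pos (-k * s)
    nlinarith
  intro s hs
  have h := h3 ⟨le_rfl, hs.1.trans hs.2⟩ hs hs.1
  simp only [mul_zero, h0] at h
  exact nonpos_of_mul_nonpos_right h (exp_pos _)

/-- Sturm comparison for two solutions with the same initial data: the one with the smaller
potential stays above, because the Wronskian makes `v / w` nondecreasing. -/
theorem sturm_le_of_pos {v v' w w' q₁ q₂ : ℝ → ℝ} {L d : ℝ}
    (hv : ∀ s ∈ Ico 0 L, HasDerivAt v (v' s) s)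
    (hv' : ∀ s ∈ Ico 0 L, HasDerivAt v' (-q₁ s * v s) s)
    (hw : ∀ s ∈ Ico 0 L, HasDerivAt w (w' s) s)
    (hw' : ∀ s ∈ Ico 0 L, HasDerivAt w' (-q₂ s * w s) s)
    (hq : ∀ s ∈ Ioo 0 L, q₁ s ≤ q₂ s) (hv0 : v 0 = 0) (hw0 : w 0 = 0) (hd : 0 < d)
    (hvd : v' 0 = d) (hwd : w' 0 = d) (hvp : ∀ s ∈ Ioo 0 L, 0 < v s)
    (hwp : ∀ s ∈ Ioo 0 L, 0 < w s) : ∀ s ∈ Ioo 0 L, w s ≤ v s := by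
  have hV : MonotoneOn (fun s => v' s * w s - v s * w' s) (Ico 0 L) := by
    have hd : ∀ s ∈ Ico 0 L, HasDerivAt (fun s => v' s * w s - v s * w' s)
        (-q₁ s * v s * w s + v' s * w' s - (v' s * w' s + v s * (-q₂ s * w s))) s :=
      fun s hs => ((hv' s hs).mul (hw s hs)).sub ((hv s hs).mul (hw' s hs))
    refine monotoneOn_of_deriv_nonneg (convex_Ico 0 L)
      (fun s hs => (hd s hs).continuousAt.continuousWithinAt)
      (fun s hs => (hd s (interior_subset hs)).differentiableAt.differentiableWithinAt)
      fun s hs => ?_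
    rw [(hd s (interior_subset hs)).deriv]
    rw [interior_Ico] at hs
    have h1 := mul_pos (hvp s hs) (hwp s hs)
    nlinarith [hq s hs]
  have hφ : MonotoneOn (fun s => v s / w s) (Ioo 0 L) := by
    have hd : ∀ s ∈ Ioo 0 L, HasDerivAt (fun s => v s / w s)
        ((v' s * w s - v s * w' s) / w s ^ 2) s :=
      fun s hs => (hv s (Ioo_subset_Ico_self hs)).div (hw s (Ioo_subset_Ico_self hs))
        (hwp s hs).ne'
    refine monotoneOn_of_deriv_nonneg (convex_Ioo 0 L)
      (fun s hs => (hd s hs).continuousAt.continuousWithinAt)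
      (fun s hs => (hd s (interior_subset hs)).differentiableAt.differentiableWithinAt)
      fun s hs => ?_
    rw [(hd s (interior_subset hs)).deriv]
    rw [interior_Ioo] at hs
    have h := hV ⟨le_rfl, hs.1.trans hs.2⟩ (Ioo_subset_Ico_self hs) hs.1.le
    simp only [hv0, hw0, mul_zero, zero_mul, sub_zero] at h
    positivity
  -- The quotient tends to `1` at the origin; only a lower bound by each `θ < 1` is needed.
  intro s hs
  have h0 : (0 : ℝ) ∈ Ico 0 L := ⟨le_rfl, hs.1.trans hs.2⟩
  have key : ∀ θ < 1, θ ≤ v s / w s := fun θ hθ => by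
    have hdθ : HasDerivAt (fun s => v s - θ * w s) (v' 0 - θ * w' 0) 0 :=
      (hv 0 h0).sub ((hw 0 h0).const_mul θ)
    have hpos : 0 < v' 0 - θ * w' 0 := by rw [hvd, hwd]; nlinarith
    obtain ⟨r, hr, hrs⟩ := ((eventually_lt_of_hasDerivAt_pos hdθ hpos).1.and
      (Ioo_mem_nhdsGT hs.1)).exists
    simp only [hv0, hw0, mul_zero, sub_zero] at hr
    have hrL : r ∈ Ioo 0 L := ⟨hrs.1, hrs.2.trans hs.2⟩
    refine le_trans ?_ (hφ hrL hs hrs.2.le)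
    rw [le_div_iff₀ (hwp r hrL)]
    linarith
  have h1 : 1 ≤ v s / w s := le_of_forall_lt_imp_le_of_dense key
  rwa [one_le_div (hwp s hs)] at h1

/-- Sturm comparison without assuming `v` positive: up to its first zero `v` dominates `w`, which is
positive there, so there is no such zero. -/
theorem sturm_le {v v' w w' q₁ q₂ : ℝ → ℝ} {L d : ℝ}
    (hv : ∀ s ∈ Ico 0 L, HasDerivAt v (v' s) s)
    (hv' : ∀ s ∈ Ico 0 L, HasDerivAt v' (-q₁ s * v s) s)
    (hw : ∀ s ∈ Ico 0 L, HasDerivAt w (w' s) s)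
    (hw' : ∀ s ∈ Ico 0 L, HasDerivAt w' (-q₂ s * w s) s)
    (hq : ∀ s ∈ Ioo 0 L, q₁ s ≤ q₂ s) (hv0 : v 0 = 0) (hw0 : w 0 = 0) (hd : 0 < d)
    (hvd : v' 0 = d) (hwd : w' 0 = d) (hwp : ∀ s ∈ Ioo 0 L, 0 < w s) :
    ∀ s ∈ Ioo 0 L, w s ≤ v s := by
  refine sturm_le_of_pos hv hv' hw hw' hq hv0 hw0 hd hvd hwd (fun s hs => ?_) hwp
  by_contra hn
  have h0 : (0 : ℝ) ∈ Ico 0 L := ⟨le_rfl, hs.1.trans hs.2⟩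
  obtain ⟨ε, hε, hpos⟩ := mem_nhdsGT_iff_exists_Ioo_subset.1
    (eventually_lt_of_hasDerivAt_pos (hv 0 h0) (by rw [hvd]; exact hd)).1
  have hpos' : ∀ r ∈ Ioo 0 ε, 0 < v r := fun r hr => by
    have : v 0 < v r := hpos hr
    rwa [hv0] at this
  have hε0 : (0 : ℝ) < ε := hε
  have hεs : ε ≤ s := not_lt.1 fun h => hn (hpos' s ⟨hs.1, h⟩)
  obtain ⟨c, hc, hc0, hcp⟩ := exists_first_zero (f := v) (a := ε / 2) (b := s) (by linarith)
    (fun r hr => (hv r ⟨by linarith [hr.1], hr.2.trans_lt hs.2⟩).continuousAt.continuousWithinAt)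
    (hpos' _ ⟨by linarith, by linarith⟩) (not_lt.1 hn)
  have hc' : 0 < c := by linarith [hc.1]
  have hcL : c < L := hc.2.trans_lt hs.2
  have hvp : ∀ r ∈ Ioo 0 c, 0 < v r := fun r hr => by
    rcases lt_or_ge r (ε / 2) with h | h
    · exact hpos' r ⟨hr.1, by linarith⟩
    · exact hcp r ⟨h, hr.2⟩
  have hle := sturm_le_of_pos (L := c) (fun r hr => hv r ⟨hr.1, hr.2.trans hcL⟩)
    (fun r hr => hv' r ⟨hr.1, hr.2.trans hcL⟩) (fun r hr => hw r ⟨hr.1, hr.2.trans hcL⟩)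
    (fun r hr => hw' r ⟨hr.1, hr.2.trans hcL⟩) (fun r hr => hq r ⟨hr.1, hr.2.trans hcL⟩)
    hv0 hw0 hd hvd hwd hvp (fun r hr => hwp r ⟨hr.1, hr.2.trans hcL⟩)
  have hmem : c ∈ closure (Ioo 0 c) := by
    rw [closure_Ioo hc'.ne]; exact ⟨hc'.le, le_rfl⟩
  have hcc : c ∈ Ico 0 L := ⟨hc'.le, hcL⟩
  have := ContinuousWithinAt.closure_le hmem (hw c hcc).continuousAt.continuousWithinAt
    (hv c hcc).continuousAt.continuousWithinAt hle
  linarith [hwp c ⟨hc', hcL⟩]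

/-- A solution of `y'' = -Q y` with nondecreasing `Q`, vanishing at the origin and positive to its
right, has a nonnegative primitive. Reflecting a negative arch about the zero where it begins, the
arch lies below the preceding values by Sturm comparison, so it cannot cancel the area gained
before. -/
theorem integral_nonneg_of_sturm {y y' Q : ℝ → ℝ} (hc : Continuous y)
    (hd : ∀ z, 0 < z → HasDerivAt y (y' z) z)
    (hd' : ∀ z, 0 < z → HasDerivAt y' (-Q z * y z) z) (hQ : MonotoneOn Q (Ioi 0))
    (h0 : y 0 = 0) {δ : ℝ} (hδ : 0 < δ) (hpos : ∀ z ∈ Ioo 0 δ, 0 < y z) {R₀ : ℝ} (hR₀ : 0 < R₀) :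
    0 ≤ ∫ z in 0..R₀, y z := by
  by_contra! hneg
  set W : ℝ → ℝ := fun R => ∫ z in 0..R, y z with hW
  have hii : ∀ a b, IntervalIntegrable y volume a b := fun a b => hc.intervalIntegrable a b
  have hWd : ∀ s, HasDerivAt W (y s) s := fun s => hc.integral_hasStrictDerivAt 0 s |>.hasDerivAt
  have hWδ : ∀ s ∈ Icc 0 (δ / 2), 0 ≤ W s := fun s hs =>
    intervalIntegral.integral_nonneg hs.1 fun u hu => by
      rcases hu.1.eq_or_lt with h | h
      · rw [← h, h0]
      · exact (hpos u ⟨h, by linarith [hu.2, hs.2]⟩).le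
  have hδR : δ / 2 < R₀ := not_le.1 fun h => absurd (hWδ R₀ ⟨hR₀.le, h⟩) (not_le.2 hneg)
  -- Tilting the primitive by a small slope makes `y` strictly negative at its first zero.
  set η := -W R₀ / (2 * R₀) with hη
  have hη0 : 0 < η := div_pos (neg_pos.2 hneg) (by linarith)
  set h : ℝ → ℝ := fun s => W s + η * s with hh
  have hhd : ∀ s, HasDerivAt h (y s + η) s := fun s =>
    ((hWd s).fun_add ((hasDerivAt_id' s).const_mul η)).congr_deriv (by ring)
  have hhR₀ : h R₀ ≤ 0 := by
    have h1 : η * R₀ = -W R₀ / 2 := by rw [hη]; field_simp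
    simp only [hh]
    rw [h1]
    linarith [show W R₀ < 0 from hneg]
  have hhδ : ∀ s ∈ Ioc 0 (δ / 2), 0 < h s := fun s hs =>
    add_pos_of_nonneg_of_pos (hWδ s ⟨hs.1.le, hs.2⟩) (mul_pos hη0 hs.1)
  obtain ⟨R, hR, hR0, hRp⟩ := exists_first_zero hδR.le
    (fun s _ => (hhd s).continuousAt.continuousWithinAt) (hhδ (δ / 2) ⟨by linarith, le_rfl⟩) hhR₀
  have hhp : ∀ s ∈ Ioo 0 R, 0 < h s := fun s hs => by
    rcases le_or_gt s (δ / 2) with h1 | h1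
    · exact hhδ s ⟨hs.1, h1⟩
    · exact hRp s ⟨h1.le, hs.2⟩
  have hRpos : 0 < R := by linarith [hR.1]
  have hyR : y R < 0 := by
    by_contra! hn
    obtain ⟨s, hs1, hs2⟩ := ((eventually_lt_of_hasDerivAt_pos (hhd R) (by linarith)).2.and
      (Ioo_mem_nhdsLT hRpos)).exists
    rw [hR0] at hs1
    linarith [hhp s hs2]
  have hRδ : δ ≤ R := not_lt.1 fun h1 => by linarith [hpos R ⟨hRpos, h1⟩]
  -- Going left from `R`, the negative arch begins at the zero `a = R - L`.
  obtain ⟨L, hL, hL0, hLp⟩ := exists_first_zero (f := fun s => -y (R - s)) (a := 0)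
    (b := R - δ / 2) (by linarith) (by fun_prop) (by simpa using hyR) (by
      have := hpos (δ / 2) ⟨by linarith, by linarith⟩
      simp only [sub_sub_cancel]; linarith)
  obtain ⟨a, rfl⟩ : ∃ a, R = a + L := ⟨R - L, by ring⟩
  have ha : 0 < a := by linarith [hL.2]
  have hya : y a = 0 := by simpa using hL0
  have hwp : ∀ s, 0 < s → s ≤ L → 0 < -y (a + s) := fun s hs hsL => by
    have := hLp (L - s) ⟨by linarith, by linarith⟩
    simpa [add_sub_assoc] using this
  have hv : ∀ s, s < a → HasDerivAt (fun s => y (a - s)) (-y' (a - s)) s := fun s hs =>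
    (hd (a - s) (by linarith)).comp_const_sub a s
  have hv' : ∀ s, s < a → HasDerivAt (fun s => -y' (a - s)) (-Q (a - s) * y (a - s)) s :=
    fun s hs => ((hd' (a - s) (by linarith)).comp_const_sub a s).fun_neg.congr_deriv (by ring)
  have hw : ∀ s, 0 ≤ s → HasDerivAt (fun s => -y (a + s)) (-y' (a + s)) s := fun s hs =>
    ((hd (a + s) (by linarith)).comp_const_add a s).fun_neg
  have hw' : ∀ s, 0 ≤ s → HasDerivAt (fun s => -y' (a + s)) (-Q (a + s) * -y (a + s)) s :=
    fun s hs => ((hd' (a + s) (by linarith)).comp_const_add a s).fun_neg.congr_deriv (by ring)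
  have hL00 : 0 < L := hL.1
  -- The zero at `a` is simple, by the maximum principle with `k² ≥ -Q` on the arch.
  have hd0 : 0 < -y' a := by
    by_contra! hn
    have h1 := nonpos_of_deriv_deriv_le (k := 1 + |Q a|) (L := L) (fun s hs => hw s hs.1)
      (fun s hs => hw' s hs.1) (fun s hs => by
        have h2 := hwp s hs.1 hs.2.le
        have h3 : Q a ≤ Q (a + s) := hQ ha (by simp; linarith [hs.1]) (by linarith [hs.1])
        have h4 := neg_abs_le (Q a)
        have h5 : -Q (a + s) ≤ (1 + |Q a|) ^ 2 := by nlinarith [abs_nonneg (Q a)]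
        exact mul_le_mul_of_nonneg_right h5 h2.le) (by simp [hya]) (by simpa using hn)
      L ⟨hL00.le, le_rfl⟩
    linarith [hwp L hL00 le_rfl]
  -- Compare the arch, reflected in sign, with `y` read backwards from `a`.
  have hcomp := sturm_le (L := min L a) (fun s hs => hv s (hs.2.trans_le (min_le_right _ _)))
    (fun s hs => hv' s (hs.2.trans_le (min_le_right _ _))) (fun s hs => hw s hs.1)
    (fun s hs => hw' s hs.1) (fun s hs => by
      have : s < a := hs.2.trans_le (min_le_right _ _)
      exact hQ (by simpa using this) (by simp; linarith [hs.1]) (by linarith [hs.1]))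
    (by simp [hya]) (by simp [hya]) hd0 (by simp) (by simp)
    (fun s hs => hwp s hs.1 (hs.2.le.trans (min_le_left _ _)))
  have hm0 : 0 < min L a := lt_min hL00 ha
  have hcomp' : ∀ s ∈ Icc 0 (min L a), -y (a + s) ≤ y (a - s) := fun s hs => by
    have hmem : s ∈ closure (Ioo 0 (min L a)) := by rwa [closure_Ioo hm0.ne]
    exact ContinuousWithinAt.closure_le hmem
      (by fun_prop : Continuous fun s => -y (a + s)).continuousWithinAt
      (by fun_prop : Continuous fun s => y (a - s)).continuousWithinAt hcomp
  -- The backward reading reaches the zero at the origin only after the arch has ended.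
  have hLa : L < a := by
    by_contra! hn
    have h1 := hcomp' a ⟨ha.le, by rw [min_eq_right hn]⟩
    rw [sub_self, h0] at h1
    linarith [hwp a ha hn]
  rw [min_eq_left hLa.le] at hcomp'
  have hleft : ∫ z in (a - L)..a, y z = ∫ s in 0..L, y (a - s) := by
    rw [intervalIntegral.integral_comp_sub_left, sub_zero]
  have hright : ∫ z in a..(a + L), y z = ∫ s in 0..L, y (a + s) := by
    rw [intervalIntegral.integral_comp_add_left, add_zero]
  have hsum : 0 ≤ (∫ s in 0..L, y (a - s)) + ∫ s in 0..L, y (a + s) := by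
    rw [← intervalIntegral.integral_add (Continuous.intervalIntegrable (by fun_prop) _ _)
      (Continuous.intervalIntegrable (by fun_prop) _ _)]
    refine intervalIntegral.integral_nonneg hL00.le fun s hs => ?_
    linarith [hcomp' s hs]
  have hsplit : W (a + L) = W (a - L) + ((∫ z in (a - L)..a, y z) + ∫ z in a..(a + L), y z) := by
    simp only [hW]
    rw [intervalIntegral.integral_add_adjacent_intervals (hii _ _) (hii _ _),
      intervalIntegral.integral_add_adjacent_intervals (hii _ _) (hii _ _)]
  -- The tilted primitive is positive at `a - L` and does not decrease from there to `a + L = R`.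
  have h1 : 0 < W (a - L) + η * (a - L) := hhp (a - L) ⟨by linarith, by linarith⟩
  have h2 : W (a + L) + η * (a + L) = 0 := hR0
  rw [hleft, hright] at hsplit
  have h3 := mul_pos hη0 hL00
  nlinarith

end sturm

/-! ### Spherical averages of the cosine and the Bessel equation -/

/-- The frequency integral is radial in `x`: a reflection exchanges any two points of equal norm. -/
theorem frequencyIntegral_eq_of_norm_eq {N : ℕ} {β : ℝ} {x x' : EuclideanSpace ℝ (Fin N)}
    (h : ‖x‖ = ‖x'‖) : frequencyIntegral N β x = frequencyIntegral N β x' := by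
  set e := Submodule.reflection (ℝ ∙ (x - x'))ᗮ with he
  have hx : e x = x' := Submodule.reflection_sub h
  rw [frequencyIntegral, ← hx, frequencyIntegral,
    ← e.measurePreserving.integral_comp e.toHomeomorph.measurableEmbedding]
  refine integral_congr_ae (.of_forall fun ξ => ?_)
  have hee : e (e ξ) = ξ := Submodule.reflection_reflection _ ξ
  simp only [LinearIsometryEquiv.norm_map]
  rw [← e.inner_map_map x (e ξ), hee]

section sphere

variable {N : ℕ} [NeZero N]

theorem integral_pow_mul_exp_neg_sq_real (k : ℕ) :
    ∫ u : ℝ, u ^ (2 * k) * exp (-u ^ 2) = Gamma (k + 1 / 2) := by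
  have h1 : (fun u : ℝ => u ^ (2 * k) * exp (-u ^ 2)) =
      fun u => (fun v : ℝ => v ^ (2 * k) * exp (-v ^ 2)) |u| := by
    funext u
    simp only [sq_abs, Even.pow_abs (even_two_mul k)]
  rw [h1, integral_comp_abs (f := fun v : ℝ => v ^ (2 * k) * exp (-v ^ 2))]
  have h2 := integral_rpow_mul_exp_neg_rpow (p := 2) (q := (2 * k : ℕ)) (by norm_num)
    (by have : (0 : ℝ) ≤ (2 * k : ℕ) := Nat.cast_nonneg _
        linarith)
  simp only [rpow_natCast, rpow_two] at h2
  rw [h2]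
  push_cast
  rw [show ((2 * k + 1) / 2 : ℝ) = k + 1 / 2 by ring]
  ring

theorem integral_coord_pow_mul_exp_neg_sq (k : ℕ) :
    ∫ ξ : EuclideanSpace ℝ (Fin N), ξ 0 ^ (2 * k) * exp (-‖ξ‖ ^ 2) =
      Gamma (k + 1 / 2) * ∏ _i ∈ Finset.univ.erase (0 : Fin N), ∫ u : ℝ, exp (-u ^ 2) := by
  set f : Fin N → ℝ → ℝ := fun i u => (if i = 0 then u ^ (2 * k) else 1) * exp (-u ^ 2) with hf
  have h1 := integral_fintype_prod_volume_eq_prod (𝕜 := ℝ) (E := fun _ : Fin N => ℝ) f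
  rw [← Finset.mul_prod_erase Finset.univ _ (Finset.mem_univ (0 : Fin N))] at h1
  have h2 : ∏ i ∈ Finset.univ.erase (0 : Fin N), ∫ u, f i u =
      ∏ _i ∈ Finset.univ.erase (0 : Fin N), ∫ u : ℝ, exp (-u ^ 2) := by
    refine Finset.prod_congr rfl fun i hi => ?_
    simp only [hf, Finset.ne_of_mem_erase hi, if_false, one_mul]
  rw [h2] at h1
  simp only [hf, if_true] at h1
  rw [integral_pow_mul_exp_neg_sq_real] at h1
  rw [← h1,
    ← (EuclideanSpace.volume_preserving_symm_measurableEquiv_toLp (Fin N)).symm.integral_comp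
    (MeasurableEquiv.measurableEmbedding _)]
  refine integral_congr_ae (.of_forall fun ξ => ?_)
  simp only
  rw [Finset.prod_mul_distrib, ← exp_sum, EuclideanSpace.norm_sq_eq]
  simp

theorem integrable_norm_pow_mul_exp_neg_sq (k : ℕ) :
    Integrable fun ξ : EuclideanSpace ℝ (Fin N) => ‖ξ‖ ^ k * exp (-‖ξ‖ ^ 2) := by
  rw [integrable_fun_norm_addHaar volume (f := fun r : ℝ => r ^ k * exp (-r ^ 2))]
  have h := integrableOn_rpow_mul_exp_neg_rpow (p := 2)
    (s := (Module.finrank ℝ (EuclideanSpace ℝ (Fin N)) - 1 + k : ℕ))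
    (by have := Nat.cast_nonneg (α := ℝ) (Module.finrank ℝ (EuclideanSpace ℝ (Fin N)) - 1 + k)
        linarith) (by norm_num)
  refine h.congr_fun (fun s _ => ?_) measurableSet_Ioi
  simp only [rpow_natCast, rpow_two, smul_eq_mul]
  ring

/-- The `2k`-th moment of a coordinate on the unit sphere. -/
noncomputable def sphereMoment (N : ℕ) [NeZero N] (k : ℕ) : ℝ :=
  ∫ ω : Metric.sphere (0 : EuclideanSpace ℝ (Fin N)) 1, (ω : EuclideanSpace ℝ (Fin N)) 0 ^ (2 * k)
    ∂(volume : Measure (EuclideanSpace ℝ (Fin N))).toSphere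

theorem integral_coord_pow_mul_exp_eq_sphereMoment (k : ℕ) :
    ∫ ξ : EuclideanSpace ℝ (Fin N), ξ 0 ^ (2 * k) * exp (-‖ξ‖ ^ 2) =
      sphereMoment N k * (1 / 2 * Gamma (k + N / 2)) := by
  have hN : 1 ≤ N := NeZero.one_le
  have hi : Integrable fun ξ : EuclideanSpace ℝ (Fin N) => ξ 0 ^ (2 * k) * exp (-‖ξ‖ ^ 2) := by
    refine (integrable_norm_pow_mul_exp_neg_sq (2 * k)).mono'
      (Continuous.aestronglyMeasurable (by fun_prop)) (.of_forall fun ξ => ?_)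
    rw [norm_mul, norm_pow, Real.norm_of_nonneg (exp_pos _).le]
    gcongr
    exact PiLp.norm_apply_le ξ 0
  rw [integral_eq_integral_toSphere_Ioi volume hi, sphereMoment, ← integral_mul_const]
  refine integral_congr_ae (.of_forall fun ω => ?_)
  have hω : ‖(ω : EuclideanSpace ℝ (Fin N))‖ = 1 := norm_eq_of_mem_sphere ω
  have h2 := integral_rpow_mul_exp_neg_rpow (p := 2) (q := (N - 1 + 2 * k : ℕ)) (by norm_num)
    (by have : (0 : ℝ) ≤ (N - 1 + 2 * k : ℕ) := Nat.cast_nonneg _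
        linarith)
  have h3 : (((N - 1 + 2 * k : ℕ) : ℝ) + 1) / 2 = k + N / 2 := by
    push_cast [Nat.cast_sub hN]; ring
  rw [h3] at h2
  simp only
  rw [← h2, ← integral_const_mul]
  refine setIntegral_congr_fun measurableSet_Ioi fun s (hs : 0 < s) => ?_
  simp only [norm_smul, hω, mul_one, Real.norm_of_nonneg hs.le, finrank_euclideanSpace_fin,
    rpow_natCast, rpow_two, PiLp.smul_apply, smul_eq_mul]
  rw [mul_pow, pow_add]
  ring

/-- The recursion comes from computing `∫ ξ₀^(2k) exp(-|ξ|²) dξ` both as a product of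
one-dimensional integrals and in polar coordinates. -/
theorem sphereMoment_succ (k : ℕ) :
    (2 * k + N : ℝ) * sphereMoment N (k + 1) = (2 * k + 1) * sphereMoment N k := by
  have hN : (1 : ℝ) ≤ N := by exact_mod_cast (NeZero.one_le : 1 ≤ N)
  have hk : (0 : ℝ) ≤ k := Nat.cast_nonneg k
  have h1 := integral_coord_pow_mul_exp_eq_sphereMoment (N := N) k
  have h2 := integral_coord_pow_mul_exp_eq_sphereMoment (N := N) (k + 1)
  rw [integral_coord_pow_mul_exp_neg_sq] at h1 h2
  have h3 : Gamma (((k + 1 : ℕ) : ℝ) + 1 / 2) = (k + 1 / 2) * Gamma (k + 1 / 2) := by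
    rw [← Gamma_add_one (by positivity)]; congr 1; push_cast; ring
  have h4 : Gamma (((k + 1 : ℕ) : ℝ) + N / 2) = (k + N / 2) * Gamma (k + N / 2) := by
    rw [← Gamma_add_one (by positivity)]; congr 1; push_cast; ring
  rw [h3, h4, mul_assoc, h1] at h2
  have h5 : 0 < Gamma (k + N / 2 : ℝ) := Gamma_pos_of_pos (by positivity)
  refine mul_right_cancel₀ h5.ne' ?_
  linarith

variable (N) in
/-- The coordinate `ω₀` as a function on the unit sphere. -/
noncomputable def sphereCoord (ω : Metric.sphere (0 : EuclideanSpace ℝ (Fin N)) 1) : ℝ :=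
  (ω : EuclideanSpace ℝ (Fin N)) 0

theorem continuous_sphereCoord : Continuous (sphereCoord N) := by
  unfold sphereCoord; fun_prop

theorem abs_sphereCoord_le_one (ω : Metric.sphere (0 : EuclideanSpace ℝ (Fin N)) 1) :
    |sphereCoord N ω| ≤ 1 := by
  have h := PiLp.norm_apply_le (ω : EuclideanSpace ℝ (Fin N)) 0
  rwa [norm_eq_of_mem_sphere ω] at h

theorem hasSum_integral_mul_cos_sphereCoord {g : Metric.sphere (0 : EuclideanSpace ℝ (Fin N)) 1 → ℝ}
    (hg : Continuous g) (hg1 : ∀ ω, |g ω| ≤ 1) (z : ℝ) :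
    HasSum (fun k : ℕ => (-1) ^ k * z ^ (2 * k) / (2 * k).factorial *
        ∫ ω, g ω * sphereCoord N ω ^ (2 * k)
          ∂(volume : Measure (EuclideanSpace ℝ (Fin N))).toSphere)
      (∫ ω, g ω * cos (z * sphereCoord N ω)
        ∂(volume : Measure (EuclideanSpace ℝ (Fin N))).toSphere) := by
  have hc := continuous_sphereCoord (N := N)
  have h := hasSum_integral_of_dominated_convergence
    (μ := (volume : Measure (EuclideanSpace ℝ (Fin N))).toSphere)
    (F := fun (k : ℕ) ω => g ω * ((-1) ^ k * (z * sphereCoord N ω) ^ (2 * k) / (2 * k).factorial))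
    (f := fun ω => g ω * cos (z * sphereCoord N ω))
    (fun k _ => |z| ^ (2 * k) / (2 * k).factorial)
    (fun k => (by fun_prop : Continuous _).aestronglyMeasurable)
    (fun k => .of_forall fun ω => by
      simp only [norm_mul, norm_div, norm_pow, norm_neg, norm_one, one_pow, one_mul, norm_eq_abs,
        Nat.abs_cast]
      have h1 : (|z| * |sphereCoord N ω|) ^ (2 * k) ≤ |z| ^ (2 * k) :=
        pow_le_pow_left₀ (by positivity)
          (mul_le_of_le_one_right (abs_nonneg _) (abs_sphereCoord_le_one ω)) _
      calc |g ω| * ((|z| * |sphereCoord N ω|) ^ (2 * k) / (2 * k).factorial)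
          ≤ 1 * (|z| ^ (2 * k) / (2 * k).factorial) := by
            gcongr
            exact hg1 ω
        _ = _ := one_mul _)
    (.of_forall fun _ => (Real.hasSum_cosh |z|).summable)
    (integrable_const _)
    (.of_forall fun ω => (Real.hasSum_cos (z * sphereCoord N ω)).mul_left (g ω))
  refine h.congr_fun fun k => ?_
  rw [← integral_const_mul]
  refine integral_congr_ae (.of_forall fun ω => ?_)
  simp only
  rw [mul_pow]
  ring

theorem hasSum_integral_mul_sin_sphereCoord {g : Metric.sphere (0 : EuclideanSpace ℝ (Fin N)) 1 → ℝ}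
    (hg : Continuous g) (hg1 : ∀ ω, |g ω| ≤ 1) (z : ℝ) :
    HasSum (fun k : ℕ => (-1) ^ k * z ^ (2 * k + 1) / (2 * k + 1).factorial *
        ∫ ω, g ω * sphereCoord N ω ^ (2 * k + 1)
          ∂(volume : Measure (EuclideanSpace ℝ (Fin N))).toSphere)
      (∫ ω, g ω * sin (z * sphereCoord N ω)
        ∂(volume : Measure (EuclideanSpace ℝ (Fin N))).toSphere) := by
  have hc := continuous_sphereCoord (N := N)
  have h := hasSum_integral_of_dominated_convergence
    (μ := (volume : Measure (EuclideanSpace ℝ (Fin N))).toSphere)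
    (F := fun (k : ℕ) ω => g ω *
      ((-1) ^ k * (z * sphereCoord N ω) ^ (2 * k + 1) / (2 * k + 1).factorial))
    (f := fun ω => g ω * sin (z * sphereCoord N ω))
    (fun k _ => |z| ^ (2 * k + 1) / (2 * k + 1).factorial)
    (fun k => (by fun_prop : Continuous _).aestronglyMeasurable)
    (fun k => .of_forall fun ω => by
      simp only [norm_mul, norm_div, norm_pow, norm_neg, norm_one, one_pow, one_mul, norm_eq_abs,
        Nat.abs_cast]
      have h1 : (|z| * |sphereCoord N ω|) ^ (2 * k + 1) ≤ |z| ^ (2 * k + 1) :=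
        pow_le_pow_left₀ (by positivity)
          (mul_le_of_le_one_right (abs_nonneg _) (abs_sphereCoord_le_one ω)) _
      calc |g ω| * ((|z| * |sphereCoord N ω|) ^ (2 * k + 1) / (2 * k + 1).factorial)
          ≤ 1 * (|z| ^ (2 * k + 1) / (2 * k + 1).factorial) := by
            gcongr
            exact hg1 ω
        _ = _ := one_mul _)
    (.of_forall fun _ => (Real.hasSum_sinh |z|).summable)
    (integrable_const _)
    (.of_forall fun ω => (Real.hasSum_sin (z * sphereCoord N ω)).mul_left (g ω))
  refine h.congr_fun fun k => ?_
  rw [← integral_const_mul]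
  refine integral_congr_ae (.of_forall fun ω => ?_)
  simp only
  rw [mul_pow]
  ring

/-- The Fourier transform of the surface measure of the unit sphere, as a function of the radius:
`z ↦ ∫ cos(z ω₀) dσ(ω)`. It is `z ^ (1 - N/2) J_{N/2 - 1}(z)` up to a constant. -/
noncomputable def sphereCos (N : ℕ) [NeZero N] (z : ℝ) : ℝ :=
  ∫ ω, cos (z * sphereCoord N ω) ∂(volume : Measure (EuclideanSpace ℝ (Fin N))).toSphere

/-- `z ↦ ∫ ω₀ sin(z ω₀) dσ(ω)`, the negative of the derivative of `sphereCos`. -/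
noncomputable def sphereSin (N : ℕ) [NeZero N] (z : ℝ) : ℝ :=
  ∫ ω, sphereCoord N ω * sin (z * sphereCoord N ω)
    ∂(volume : Measure (EuclideanSpace ℝ (Fin N))).toSphere

theorem hasDerivAt_sphereCos (z : ℝ) : HasDerivAt (sphereCos N) (-sphereSin N z) z := by
  have hc := continuous_sphereCoord (N := N)
  have h := hasDerivAt_integral_of_dominated_loc_of_deriv_le
    (μ := (volume : Measure (EuclideanSpace ℝ (Fin N))).toSphere) (x₀ := z) (s := Set.univ)
    (F := fun z ω => cos (z * sphereCoord N ω))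
    (F' := fun z ω => -(sphereCoord N ω * sin (z * sphereCoord N ω))) (bound := fun _ => 1)
    Filter.univ_mem
    (.of_forall fun z => (by fun_prop : Continuous _).aestronglyMeasurable)
    ((by fun_prop : Continuous fun ω => cos (z * sphereCoord N ω)).integrable_of_hasCompactSupport
      (.of_compactSpace _))
    (by fun_prop : Continuous _).aestronglyMeasurable
    (.of_forall fun ω z _ => by
      rw [norm_neg, norm_mul]
      exact mul_le_one₀ (abs_sphereCoord_le_one ω) (norm_nonneg _) (abs_sin_le_one _))
    (integrable_const _)
    (.of_forall fun ω z _ => by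
      refine (((hasDerivAt_id' z).mul_const (sphereCoord N ω)).cos).congr_deriv (by ring))
  refine h.2.congr_deriv ?_
  rw [integral_neg, sphereSin]

theorem hasDerivAt_sphereSin (z : ℝ) : HasDerivAt (sphereSin N)
    (∫ ω, sphereCoord N ω ^ 2 * cos (z * sphereCoord N ω)
      ∂(volume : Measure (EuclideanSpace ℝ (Fin N))).toSphere) z := by
  have hc := continuous_sphereCoord (N := N)
  refine (hasDerivAt_integral_of_dominated_loc_of_deriv_le
    (μ := (volume : Measure (EuclideanSpace ℝ (Fin N))).toSphere) (x₀ := z) (s := Set.univ)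
    (F := fun z ω => sphereCoord N ω * sin (z * sphereCoord N ω))
    (F' := fun z ω => sphereCoord N ω ^ 2 * cos (z * sphereCoord N ω)) (bound := fun _ => 1)
    Filter.univ_mem
    (.of_forall fun z => (by fun_prop : Continuous _).aestronglyMeasurable)
    ((by fun_prop : Continuous fun ω => sphereCoord N ω *
      sin (z * sphereCoord N ω)).integrable_of_hasCompactSupport (.of_compactSpace _))
    (by fun_prop : Continuous _).aestronglyMeasurable
    (.of_forall fun ω z _ => by
      rw [norm_mul, norm_pow]
      exact mul_le_one₀ (pow_le_one₀ (norm_nonneg _) (abs_sphereCoord_le_one ω)) (norm_nonneg _)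
        (abs_cos_le_one _))
    (integrable_const _)
    (.of_forall fun ω z _ => by
      refine ((((hasDerivAt_id' z).mul_const (sphereCoord N ω)).sin).const_mul
        (sphereCoord N ω)).congr_deriv (by ring))).2

/-- The Bessel equation for `u = sphereCos`, in the form `z (u + u'') = -(N - 1) u'`: both sides
have the same power series, by the recursion for the moments. -/
theorem sphereCos_bessel (z : ℝ) :
    z * (sphereCos N z - ∫ ω, sphereCoord N ω ^ 2 * cos (z * sphereCoord N ω)
      ∂(volume : Measure (EuclideanSpace ℝ (Fin N))).toSphere) = (N - 1) * sphereSin N z := by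
  have hc := continuous_sphereCoord (N := N)
  have h0 := hasSum_integral_mul_cos_sphereCoord (N := N) (g := fun _ => 1) (by fun_prop)
    (by simp) z
  have h2 := hasSum_integral_mul_cos_sphereCoord (N := N) (g := fun ω => sphereCoord N ω ^ 2)
    (by fun_prop) (fun ω => by
      rw [abs_pow]; exact pow_le_one₀ (abs_nonneg _) (abs_sphereCoord_le_one ω)) z
  have h1 := hasSum_integral_mul_sin_sphereCoord (N := N) (g := fun ω => sphereCoord N ω)
    (by fun_prop) abs_sphereCoord_le_one z
  have e0 : ∀ k : ℕ, ∫ ω, 1 * sphereCoord N ω ^ (2 * k)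
      ∂(volume : Measure (EuclideanSpace ℝ (Fin N))).toSphere = sphereMoment N k := fun k => by
    simp only [one_mul, sphereCoord, sphereMoment]
  have e2 : ∀ k : ℕ, ∫ ω, sphereCoord N ω ^ 2 * sphereCoord N ω ^ (2 * k)
      ∂(volume : Measure (EuclideanSpace ℝ (Fin N))).toSphere = sphereMoment N (k + 1) :=
    fun k => by
    simp only [← pow_add, sphereCoord, sphereMoment]
    rw [show 2 + 2 * k = 2 * (k + 1) by ring]
  have e1 : ∀ k : ℕ, ∫ ω, sphereCoord N ω * sphereCoord N ω ^ (2 * k + 1)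
      ∂(volume : Measure (EuclideanSpace ℝ (Fin N))).toSphere = sphereMoment N (k + 1) :=
    fun k => by
    simp only [← pow_succ', sphereCoord, sphereMoment]
    rw [show 2 * k + 1 + 1 = 2 * (k + 1) by ring]
  simp only [e0] at h0
  simp only [one_mul] at h0
  simp only [e2] at h2
  simp only [e1] at h1
  refine HasSum.unique ((h0.sub h2).mul_left z) ?_
  refine (h1.mul_left ((N : ℝ) - 1)).congr_fun fun k => ?_
  have hm := sphereMoment_succ (N := N) k
  have hf : (((2 * k + 1).factorial : ℕ) : ℝ) = (2 * k + 1) * (2 * k).factorial := by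
    rw [Nat.factorial_succ]; push_cast; ring
  have hf0 : ((2 * k).factorial : ℝ) ≠ 0 := by positivity
  have hk : (2 * k + 1 : ℝ) ≠ 0 := by positivity
  have hd : (2 * k + 1) * (sphereMoment N k - sphereMoment N (k + 1)) =
      (N - 1) * sphereMoment N (k + 1) := by linarith
  rw [hf]
  field_simp
  rw [pow_succ]
  linear_combination (z ^ (2 * k) * z) * hd

theorem continuous_sphereCos : Continuous (sphereCos N) :=
  continuous_iff_continuousAt.2 fun z => (hasDerivAt_sphereCos z).continuousAt

theorem abs_sphereCos_le (z : ℝ) : |sphereCos N z| ≤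
    (volume : Measure (EuclideanSpace ℝ (Fin N))).toSphere.real Set.univ := by
  have h := norm_integral_le_of_norm_le_const
    (μ := (volume : Measure (EuclideanSpace ℝ (Fin N))).toSphere)
    (f := fun ω => cos (z * sphereCoord N ω)) (C := 1) (.of_forall fun ω => abs_cos_le_one _)
  rwa [one_mul] at h

theorem sphereCos_pos {z : ℝ} (hz : |z| ≤ 1) : 0 < sphereCos N z := by
  have hpos : ∀ ω, 0 < cos (z * sphereCoord N ω) := fun ω => by
    have h : |z * sphereCoord N ω| ≤ 1 := by
      rw [abs_mul]; exact mul_le_one₀ hz (abs_nonneg _) (abs_sphereCoord_le_one ω)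
    exact cos_pos_of_le_one h
  have hc := continuous_sphereCoord (N := N)
  rw [sphereCos, integral_pos_iff_support_of_nonneg (fun ω => (hpos ω).le)
    ((by fun_prop : Continuous fun ω => cos (z * sphereCoord N ω)).integrable_of_hasCompactSupport
      (.of_compactSpace _)),
    Set.eq_univ_of_forall (s := Function.support _) fun ω => (hpos ω).ne',
    Measure.measure_univ_pos]
  exact Measure.toSphere_ne_zero _

/-- The substitution `y = z ^ ((N - 1)/2) u` removes the first-order term of the Bessel equation.
Its potential `1 - p (p - 1)/z²` is nondecreasing because `p ≥ 1` in dimension at least `3`. -/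
theorem integral_rpow_mul_sphereCos_nonneg (hN : 3 ≤ N) {R : ℝ} (hR : 0 < R) :
    0 ≤ ∫ z in 0..R, z ^ (((N : ℝ) - 1) / 2) * sphereCos N z := by
  have hN' : (3 : ℝ) ≤ N := by exact_mod_cast hN
  set p := ((N : ℝ) - 1) / 2 with hp
  have hp1 : 1 ≤ p := by rw [hp]; linarith
  have hrp : ∀ (a z : ℝ), 0 < z → HasDerivAt (fun z : ℝ => z ^ a) (a * z ^ (a - 1)) z :=
    fun a z hz => Real.hasDerivAt_rpow_const (.inl hz.ne')
  refine integral_nonneg_of_sturm (y := fun z => z ^ p * sphereCos N z)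
    (y' := fun z => p * z ^ (p - 1) * sphereCos N z + z ^ p * -sphereSin N z)
    (Q := fun z => 1 - p * (p - 1) / z ^ 2) (δ := 1)
    ((continuous_id.rpow_const fun z => .inr (by linarith)).mul continuous_sphereCos)
    (fun z hz => (hrp p z hz).mul (hasDerivAt_sphereCos z)) (fun z hz => ?_) ?_ ?_ one_pos ?_ hR
  · refine ((((hrp (p - 1) z hz).const_mul p).mul (hasDerivAt_sphereCos z)).add
      ((hrp p z hz).mul (hasDerivAt_sphereSin z).fun_neg)).congr_deriv ?_
    have hb := sphereCos_bessel (N := N) z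
    set B := ∫ ω, sphereCoord N ω ^ 2 * cos (z * sphereCoord N ω)
      ∂(volume : Measure (EuclideanSpace ℝ (Fin N))).toSphere
    have h1 : z ^ (p - 1) = z ^ (p - 1 - 1) * z := by
      rw [← rpow_add_one hz.ne']; congr 1; ring
    have h2 : z ^ p = z ^ (p - 1 - 1) * z ^ 2 := by
      rw [← rpow_natCast, ← rpow_add hz]; congr 1; push_cast; ring
    have hNp : (N : ℝ) - 1 = 2 * p := by rw [hp]; ring
    rw [hNp] at hb
    rw [h2, h1]
    field_simp
    linear_combination z * hb
  · intro u (hu : 0 < u) v _ huv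
    have h : p * (p - 1) / v ^ 2 ≤ p * (p - 1) / u ^ 2 := by
      have : 0 ≤ p * (p - 1) := mul_nonneg (by linarith) (by linarith)
      gcongr
    simp only
    linarith
  · rw [zero_rpow (by linarith), zero_mul]
  · intro z hz
    exact mul_pos (rpow_pos_of_pos hz.1 _)
      (sphereCos_pos (by rw [abs_of_pos hz.1]; exact hz.2.le))

theorem frequencyIntegral_eq_integral_sphereCos {β : ℝ} (h0 : 0 < β) (hβ : β ≤ N)
    (x : EuclideanSpace ℝ (Fin N)) :
    frequencyIntegral N β x =
      ∫ s in Set.Ioi (0 : ℝ), s ^ (β - 1) * exp (-1 * s ^ 4) * sphereCos N (‖x‖ * s) := by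
  set x' : EuclideanSpace ℝ (Fin N) := ‖x‖ • EuclideanSpace.single 0 1 with hx'
  have hn : ‖x‖ = ‖x'‖ := by simp [hx', norm_smul]
  have hin : ∀ ω : Metric.sphere (0 : EuclideanSpace ℝ (Fin N)) 1,
      inner ℝ x' (ω : EuclideanSpace ℝ (Fin N)) = ‖x‖ * sphereCoord N ω := fun ω => by
    simp [hx', inner_smul_left, sphereCoord, EuclideanSpace.inner_single_left]
  have hc := continuous_sphereCoord (N := N)
  rw [frequencyIntegral_eq_of_norm_eq hn, frequencyIntegral_eq_integral_toSphere h0 hβ]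
  simp only [hin]
  rw [integral_integral_swap]
  · refine setIntegral_congr_fun measurableSet_Ioi fun s _ => ?_
    rw [integral_const_mul, sphereCos]
    congr 1
    refine integral_congr_ae (.of_forall fun ω => ?_)
    simp only
    rw [mul_right_comm]
  · have hexp : IntegrableOn (fun s : ℝ => s ^ (β - 1) * exp (-1 * s ^ 4)) (Set.Ioi 0) :=
      integrableOn_rpow_mul_exp_neg_pow_four (by linarith)
    have hm : Measurable fun q : Metric.sphere (0 : EuclideanSpace ℝ (Fin N)) 1 × ℝ =>
        ‖x‖ * sphereCoord N q.1 * q.2 :=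
      (by fun_prop : Continuous fun q : Metric.sphere (0 : EuclideanSpace ℝ (Fin N)) 1 × ℝ =>
        ‖x‖ * sphereCoord N q.1 * q.2).measurable
    refine (hexp.norm.comp_snd
      (volume : Measure (EuclideanSpace ℝ (Fin N))).toSphere).mono'
      (Measurable.aestronglyMeasurable ?_) (.of_forall fun q => ?_)
    · exact Measurable.mul (by fun_prop) (measurable_cos.comp hm)
    · simp only [Function.uncurry]
      rw [norm_mul]
      exact mul_le_of_le_one_right (norm_nonneg _) (abs_cos_le_one _)

theorem frequencyIntegral_pos_of_le_succ_div_two (hN : 3 ≤ N) {β : ℝ} (h0 : 0 < β)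
    (hβ : β ≤ ((N : ℝ) + 1) / 2) (x : EuclideanSpace ℝ (Fin N)) :
    0 < frequencyIntegral N β x := by
  have hN' : (3 : ℝ) ≤ N := by exact_mod_cast hN
  rw [frequencyIntegral_eq_integral_sphereCos h0 (by linarith)]
  set p := ((N : ℝ) - 1) / 2 with hp
  set r := ‖x‖ with hr
  have hr0 : 0 ≤ r := norm_nonneg x
  have hcs := continuous_sphereCos (N := N)
  have hcf : Continuous fun s : ℝ => s ^ p * sphereCos N (r * s) :=
    (continuous_id.rpow_const fun z => .inr (by linarith)).mul (by fun_prop)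
  have h := integral_rpow_mul_exp_mul_pos (p := p)
    (C := (volume : Measure (EuclideanSpace ℝ (Fin N))).toSphere.real Set.univ)
    (by linarith) h0 (by linarith) (f := fun s => s ^ p * sphereCos N (r * s))
    hcf.continuousOn
    (fun s hs => by
      rw [abs_mul, abs_of_pos (rpow_pos_of_pos hs p), mul_comm]
      gcongr
      exact abs_sphereCos_le _)
    (fun R hR => ?_) ⟨(r + 1)⁻¹, by positivity, ?_⟩
  · refine h.trans_eq (setIntegral_congr_fun measurableSet_Ioi fun s (hs : 0 < s) => ?_)
    have h1 : s ^ (β - 1) = s ^ (β - 1 - p) * s ^ p := by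
      rw [← rpow_add hs]; congr 1; ring
    rw [h1]
    ring
  · rcases hr0.eq_or_lt with h | h
    · rw [← h]
      refine intervalIntegral.integral_nonneg hR.le fun s hs => mul_nonneg (rpow_nonneg hs.1 _) ?_
      exact (sphereCos_pos (by simp)).le
    · have h1 : ∫ s in 0..R, s ^ p * sphereCos N (r * s) =
          ∫ s in 0..R, r ^ (-p) * ((r * s) ^ p * sphereCos N (r * s)) := by
        refine intervalIntegral.integral_congr fun s hs => ?_
        rw [Set.uIcc_of_le hR.le] at hs
        rw [mul_rpow h.le hs.1, rpow_neg h.le, ← mul_assoc, inv_mul_cancel_left₀ (by positivity)]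
      rw [h1, intervalIntegral.integral_const_mul, intervalIntegral.integral_comp_mul_left
        (fun u => u ^ p * sphereCos N u) h.ne', mul_zero, smul_eq_mul]
      have := integral_rpow_mul_sphereCos_nonneg hN (mul_pos h hR)
      positivity
  · refine intervalIntegral.intervalIntegral_pos_of_pos_on (hcf.intervalIntegrable _ _)
      (fun s hs => mul_pos (rpow_pos_of_pos hs.1 _) (sphereCos_pos ?_)) (by positivity)
    rw [abs_of_nonneg (mul_nonneg hr0 hs.1.le)]
    have h1 := hs.2.le
    rw [inv_eq_one_div, le_div_iff₀ (by positivity)] at h1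
    nlinarith [hs.1]

end sphere

/-! ### Perturbation of the exponent -/

section perturbation

open Set Filter Topology

theorem rpow_sub_rpow_le {a b β : ℝ} (hb : 0 ≤ b) (hab : b ≤ a) (hβ : 1 ≤ β) :
    a ^ β - b ^ β ≤ β * (a - b) * a ^ (β - 1) := by
  rcases (hb.trans hab).eq_or_lt with h | h
  · have hb0 : b = 0 := le_antisymm (h ▸ hab) hb
    simp [← h, hb0]
  · have h1 := one_add_mul_self_le_rpow_one_add (s := b / a - 1) (p := β)
      (by have : 0 ≤ b / a := by positivity
          linarith) hβ
    rw [add_sub_cancel, div_rpow hb h.le, le_div_iff₀ (rpow_pos_of_pos h β)] at h1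
    have h2 : a ^ β = a ^ (β - 1) * a := by
      rw [← rpow_add_one h.ne']; congr 1; ring
    have h3 : (1 + β * (b / a - 1)) * a ^ β = a ^ β - β * (a - b) * a ^ (β - 1) := by
      rw [h2]; field_simp; ring
    linarith

theorem abs_rpow_sub_rpow_mul_rpow_neg_le {r s d β : ℝ} (hr : 0 ≤ r) (hs : 0 < s)
    (hd : |r - s| ≤ d) (hβ : 1 ≤ β) :
    |r ^ β * s ^ (-β) - 1| ≤ β * 2 ^ (β - 1) * (d * s ^ (-1 : ℝ) + d ^ β * s ^ (-β)) := by
  have hd0 : 0 ≤ d := (abs_nonneg _).trans hd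
  have h1 : |r ^ β - s ^ β| ≤ β * d * (s + d) ^ (β - 1) := by
    rcases le_total s r with h | h
    · have h2 := rpow_sub_rpow_le hs.le h hβ
      rw [abs_of_nonneg (sub_nonneg.2 h)] at hd
      rw [abs_of_nonneg (sub_nonneg.2 (rpow_le_rpow hs.le h (by linarith)))]
      refine h2.trans ?_
      gcongr
      linarith
    · have h2 := rpow_sub_rpow_le hr h hβ
      rw [abs_sub_comm, abs_of_nonneg (sub_nonneg.2 h)] at hd
      rw [abs_sub_comm, abs_of_nonneg (sub_nonneg.2 (rpow_le_rpow hr h (by linarith)))]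
      refine h2.trans ?_
      gcongr
      linarith
  have h2 : (s + d) ^ (β - 1) ≤ 2 ^ (β - 1) * (s ^ (β - 1) + d ^ (β - 1)) :=
    add_rpow_le_two_rpow_mul hs.le hd0 (by linarith)
  have hsp : s ^ β * s ^ (-β) = 1 := by rw [← rpow_add hs, add_neg_cancel, rpow_zero]
  have hs1 : s ^ (β - 1) * s ^ (-β) = s ^ (-1 : ℝ) := by rw [← rpow_add hs]; congr 1; ring
  have hd1 : d * d ^ (β - 1) = d ^ β := by
    rcases hd0.eq_or_lt with h | h
    · rw [← h, zero_mul, zero_rpow (by linarith)]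
    · rw [mul_comm, ← rpow_add_one h.ne']; congr 1; ring
  have hn : 0 < s ^ (-β) := rpow_pos_of_pos hs _
  calc |r ^ β * s ^ (-β) - 1| = |r ^ β - s ^ β| * s ^ (-β) := by
        rw [← hsp, ← sub_mul, abs_mul, abs_of_pos hn]
    _ ≤ β * d * (2 ^ (β - 1) * (s ^ (β - 1) + d ^ (β - 1))) * s ^ (-β) := by
        gcongr
        exact h1.trans (by gcongr)
    _ = β * 2 ^ (β - 1) * (d * (s ^ (β - 1) * s ^ (-β)) + d * d ^ (β - 1) * s ^ (-β)) := by ring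
    _ = _ := by rw [hs1, hd1]

theorem exists_abs_fundSol_mul_pow_le (N : ℕ) : ∃ C, 0 < C ∧
    ∀ z : EuclideanSpace ℝ (Fin N),
      |fundSol N z 1| * (1 + ‖z‖) ^ N ≤ C * decayWeight N z := by
  obtain ⟨C, hC, h⟩ := exists_abs_fundSol_le (N := N) one_pos (3 * N + 1)
  refine ⟨C, hC, fun z => ?_⟩
  have hz : 0 < 1 + ‖z‖ := by positivity
  have h1 : decayWeight N z = (1 + ‖z‖) ^ (-((3 * N + 1 : ℕ) : ℝ)) * (1 + ‖z‖) ^ N := by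
    rw [decayWeight, ← rpow_natCast (1 + ‖z‖) N, ← rpow_add hz]
    congr 1; push_cast; ring
  rw [h1, ← mul_assoc]
  gcongr
  exact h z

variable {N : ℕ} [NeZero N]

/-- Far from the origin `S(1)|·|^(-β)` is close to `|x|^(-β)`, uniformly for `β` in compact
subsets of `[1, N)`, hence positive. -/
theorem exists_powerEvolution_pos_of_le_norm {Γ : ℝ} (hΓ1 : 1 ≤ Γ) (hΓ : Γ < N) :
    ∃ R, 0 < R ∧ ∀ β, 1 ≤ β → β ≤ Γ → ∀ x : EuclideanSpace ℝ (Fin N), R ≤ ‖x‖ →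
      0 < powerEvolution N β 1 x := by
  obtain ⟨C₁, hC₁, hG⟩ := exists_abs_fundSol_mul_pow_le N
  obtain ⟨C₂, hC₂, hI⟩ := exists_integral_decayWeight_mul_norm_rpow_neg_le hΓ
  set K := C₁ * (Γ * 2 ^ (Γ - 1)) with hK
  have hK0 : 0 < K := by positivity
  refine ⟨2 * (K * C₂), by positivity, fun β h1 hβ x hx => ?_⟩
  have hr : 0 < ‖x‖ := lt_of_lt_of_le (by positivity) hx
  have hβN : β < N := hβ.trans_lt hΓ
  obtain ⟨hi1, hb1⟩ := hI 1 zero_le_one hΓ1 x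
  obtain ⟨hi2, hb2⟩ := hI β (by linarith) hβ x
  have hg : Integrable fun y : EuclideanSpace ℝ (Fin N) => fundSol N (x - y) 1 :=
    .comp_sub_left (by
      by_contra hcon
      have := integral_fundSol (N := N) one_pos
      rw [integral_undef hcon] at this
      exact zero_ne_one this) x
  have hg1 : ∫ y : EuclideanSpace ℝ (Fin N), fundSol N (x - y) 1 = 1 := by
    rw [integral_sub_left_eq_self (fun y => fundSol N y 1), integral_fundSol one_pos]
  have hgi := integrable_fundSol_mul_norm_rpow_neg (N := N) one_pos (by linarith) hβN x
  have hdiff : ‖x‖ ^ β * powerEvolution N β 1 x - 1 =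
      ∫ y, fundSol N (x - y) 1 * (‖x‖ ^ β * ‖y‖ ^ (-β) - 1) := by
    calc ‖x‖ ^ β * powerEvolution N β 1 x - 1
        = (∫ y, ‖x‖ ^ β * (fundSol N (x - y) 1 * ‖y‖ ^ (-β))) -
          ∫ y : EuclideanSpace ℝ (Fin N), fundSol N (x - y) 1 := by
          rw [hg1, integral_const_mul]; rfl
      _ = ∫ y, fundSol N (x - y) 1 * (‖x‖ ^ β * ‖y‖ ^ (-β) - 1) := by
          rw [← integral_sub (hgi.const_mul _) hg]
          refine integral_congr_ae (.of_forall fun y => ?_)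
          simp only
          ring
  have hae : ∀ᵐ y : EuclideanSpace ℝ (Fin N), y ≠ 0 :=
    compl_mem_ae_iff.2 (measure_singleton 0)
  have hbound : |‖x‖ ^ β * powerEvolution N β 1 x - 1| ≤
      K * ((∫ y, decayWeight N (x - y) * ‖y‖ ^ (-1 : ℝ)) +
        ∫ y, decayWeight N (x - y) * ‖y‖ ^ (-β)) := by
    rw [hdiff, ← integral_add hi1 hi2, ← integral_const_mul]
    have hsum : Integrable fun y => K * (decayWeight N (x - y) * ‖y‖ ^ (-1 : ℝ) +
        decayWeight N (x - y) * ‖y‖ ^ (-β)) := (hi1.add hi2).const_mul K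
    rw [← norm_eq_abs]
    refine norm_integral_le_of_norm_le hsum ?_
    filter_upwards [hae] with y hy
    have hy0 : 0 < ‖y‖ := norm_pos_iff.2 hy
    set d := ‖x - y‖ with hd
    have hd0 : 0 ≤ d := norm_nonneg _
    have hp := abs_rpow_sub_rpow_mul_rpow_neg_le hr.le hy0 (abs_norm_sub_norm_le x y) h1
    have hN1 : 1 ≤ N := NeZero.one_le
    have hdN : d ≤ (1 + d) ^ N :=
      (by linarith : d ≤ 1 + d).trans (le_self_pow₀ (by linarith) (by omega))
    have hdβ : d ^ β ≤ (1 + d) ^ N := by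
      rw [← rpow_natCast (1 + d) N]
      exact (rpow_le_rpow hd0 (by linarith) (by linarith)).trans
        (rpow_le_rpow_of_exponent_le (by linarith) hβN.le)
    have h2 : β * 2 ^ (β - 1) ≤ Γ * 2 ^ (Γ - 1) := by
      gcongr
      norm_num
    rw [norm_mul, norm_eq_abs, norm_eq_abs]
    calc |fundSol N (x - y) 1| * |‖x‖ ^ β * ‖y‖ ^ (-β) - 1|
        ≤ |fundSol N (x - y) 1| * (Γ * 2 ^ (Γ - 1) *
          ((1 + d) ^ N * ‖y‖ ^ (-1 : ℝ) + (1 + d) ^ N * ‖y‖ ^ (-β))) := by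
          gcongr
          refine hp.trans ?_
          gcongr
      _ = |fundSol N (x - y) 1| * (1 + d) ^ N * (Γ * 2 ^ (Γ - 1) *
          (‖y‖ ^ (-1 : ℝ) + ‖y‖ ^ (-β))) := by ring
      _ ≤ C₁ * decayWeight N (x - y) * (Γ * 2 ^ (Γ - 1) *
          (‖y‖ ^ (-1 : ℝ) + ‖y‖ ^ (-β))) := by
          exact mul_le_mul_of_nonneg_right (hG (x - y)) (by positivity)
      _ = K * (decayWeight N (x - y) * ‖y‖ ^ (-1 : ℝ) + decayWeight N (x - y) * ‖y‖ ^ (-β)) := by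
          rw [hK]; ring
  have h3 : (1 + ‖x‖) ^ (-β) ≤ (1 + ‖x‖) ^ (-1 : ℝ) :=
    rpow_le_rpow_of_exponent_le (by linarith) (by linarith)
  have h4 : |‖x‖ ^ β * powerEvolution N β 1 x - 1| ≤ 2 * (K * C₂) * (1 + ‖x‖) ^ (-1 : ℝ) := by
    refine hbound.trans ?_
    calc _ ≤ K * (C₂ * (1 + ‖x‖) ^ (-1 : ℝ) + C₂ * (1 + ‖x‖) ^ (-1 : ℝ)) := by
          gcongr
          exact hb2.trans (by gcongr)
      _ = _ := by ring
  have h5 : 2 * (K * C₂) * (1 + ‖x‖) ^ (-1 : ℝ) < 1 := by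
    rw [rpow_neg_one, ← div_eq_mul_inv, div_lt_one (by positivity)]
    linarith
  have h6 := (abs_lt.1 (h4.trans_lt h5)).1
  exact pos_of_mul_pos_right (a := ‖x‖ ^ β) (by linarith) (by positivity)

theorem continuousOn_frequencyIntegral {b₀ b₁ : ℝ} (h0 : 0 < b₀) (h01 : b₀ ≤ b₁) (h1 : b₁ ≤ N) :
    ContinuousOn (fun p : ℝ × EuclideanSpace ℝ (Fin N) => frequencyIntegral N p.1 p.2)
      (Icc b₀ b₁ ×ˢ univ) := by
  have hae : ∀ᵐ y : EuclideanSpace ℝ (Fin N), y ≠ 0 :=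
    compl_mem_ae_iff.2 (measure_singleton 0)
  unfold frequencyIntegral
  refine continuousOn_of_dominated
    (bound := fun ξ => ‖ξ‖ ^ (b₀ - N) * exp (-1 * ‖ξ‖ ^ 4) + ‖ξ‖ ^ (b₁ - N) * exp (-1 * ‖ξ‖ ^ 4))
    (fun p _ => Measurable.aestronglyMeasurable (by fun_prop)) (fun p hp => ?_)
    ((integrable_norm_rpow_mul_exp h0 (h01.trans h1)).add
      (integrable_norm_rpow_mul_exp (h0.trans_le h01) h1)) ?_
  · filter_upwards [hae] with ξ hξ
    have hξ0 : 0 < ‖ξ‖ := norm_pos_iff.2 hξ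
    have hle : ‖ξ‖ ^ (p.1 - N) ≤ ‖ξ‖ ^ (b₀ - N) + ‖ξ‖ ^ (b₁ - N) := by
      have hp0 := rpow_pos_of_pos hξ0 (b₀ - N)
      have hp1 := rpow_pos_of_pos hξ0 (b₁ - N)
      rcases le_total ‖ξ‖ 1 with h | h
      · have := rpow_le_rpow_of_exponent_ge hξ0 h (sub_le_sub_right hp.1.1 (N : ℝ))
        linarith
      · have := rpow_le_rpow_of_exponent_le h (sub_le_sub_right hp.1.2 (N : ℝ))
        linarith
    rw [norm_mul, norm_mul, Real.norm_of_nonneg (rpow_pos_of_pos hξ0 _).le,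
      Real.norm_of_nonneg (exp_pos _).le, ← add_mul]
    refine mul_le_mul hle ?_ (by positivity) (by positivity)
    exact mul_le_of_le_one_right (exp_pos _).le (abs_cos_le_one _)
  · filter_upwards [hae] with ξ hξ
    refine Continuous.continuousOn (.mul ?_ (by fun_prop))
    exact continuous_const.rpow (by fun_prop) fun _ => .inl (norm_ne_zero_iff.2 hξ)

/-- In dimension at least `3` positivity persists slightly beyond the exponent `(N + 1) / 2`: on a
fixed ball by continuity in the exponent, outside of it by the uniform asymptotics. -/
theorem exists_powerEvolution_pos_of_lt (hN : 3 ≤ N) :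
    ∃ δ : ℝ, 0 < δ ∧ ((N : ℝ) + 1) / 2 + δ < N ∧
      ∀ β, 0 < β → β < ((N : ℝ) + 1) / 2 + δ → ∀ x : EuclideanSpace ℝ (Fin N),
        0 < powerEvolution N β 1 x := by
  have hN' : (3 : ℝ) ≤ N := by exact_mod_cast hN
  obtain ⟨R, -, hR⟩ := exists_powerEvolution_pos_of_le_norm (N := N) (Γ := N - 1 / 2)
    (by linarith) (by linarith)
  set b := ((N : ℝ) + 1) / 2 with hb
  have hev : ∀ᶠ β in 𝓝 b, ∀ x ∈ Metric.closedBall (0 : EuclideanSpace ℝ (Fin N)) R,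
      0 < frequencyIntegral N β x := by
    refine (isCompact_closedBall (0 : EuclideanSpace ℝ (Fin N)) R
      ).eventually_forall_of_forall_eventually fun x _ => ?_
    have hc : ContinuousAt
        (fun p : ℝ × EuclideanSpace ℝ (Fin N) => frequencyIntegral N p.1 p.2) (b, x) :=
      (continuousOn_frequencyIntegral one_pos (by linarith) le_rfl).continuousAt
        (prod_mem_nhds (Icc_mem_nhds (by linarith) (by linarith)) univ_mem)
    exact hc.eventually_const_lt
      (frequencyIntegral_pos_of_le_succ_div_two hN (by linarith) le_rfl x)
  obtain ⟨ε, hε, hball⟩ := Metric.eventually_nhds_iff.1 hev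
  have hδ1 := min_le_left ε (1 / 4 : ℝ)
  have hδ2 := min_le_right ε (1 / 4 : ℝ)
  refine ⟨min ε (1 / 4), by positivity, by linarith, fun β h0 hβ x => ?_⟩
  rcases le_or_gt β b with h | h
  · rw [powerEvolution_one_pos_iff h0 (by linarith)]
    exact frequencyIntegral_pos_of_le_succ_div_two hN h0 h x
  · rcases le_or_gt R ‖x‖ with hx | hx
    · exact hR β (by linarith) (by linarith) x hx
    · rw [powerEvolution_one_pos_iff h0 (by linarith)]
      refine hball ?_ x (by simpa using hx.le)
      rw [Real.dist_eq, abs_of_pos (sub_pos.2 h)]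
      linarith

end perturbation

/-! ### Conclusion -/

theorem powerEvolution_pos_of_one {N : ℕ} {β t : ℝ} (ht : 0 < t)
    (h : ∀ x, 0 < powerEvolution N β 1 x) (x : EuclideanSpace ℝ (Fin N)) :
    0 < powerEvolution N β t x := by
  rw [powerEvolution_eq_smul ht]
  exact mul_pos (by positivity) (h _)

theorem exists_isPositivityThreshold (N : ℕ) [NeZero N] : ∃ β₁, IsPositivityThreshold N β₁ := by
  rcases lt_or_ge N 3 with h | h
  · have hN1 : (1 : ℝ) ≤ N := by exact_mod_cast (NeZero.one_le : 1 ≤ N)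
    refine ⟨11 / 20, ⟨by norm_num, by linarith⟩, ?_, fun β hβ x t ht =>
      powerEvolution_pos_of_one ht (fun x => ?_) x⟩
    · rw [thresholdLowerBound, if_neg (by omega)]
      split_ifs <;> norm_num
    · rw [powerEvolution_one_pos_iff hβ.1 (by linarith [hβ.2])]
      exact frequencyIntegral_pos_of_le_eleven_div_twenty hβ.1 hβ.2.le x
  · obtain ⟨δ, hδ, hδN, hpos⟩ := exists_powerEvolution_pos_of_lt h
    refine ⟨((N : ℝ) + 1) / 2 + δ, ⟨by positivity, hδN⟩, ?_, fun β hβ x t ht =>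
      powerEvolution_pos_of_one ht (hpos β hβ.1 hβ.2) x⟩
    rw [thresholdLowerBound, if_pos h]
    linarith

end BiharmonicHeat

open BiharmonicHeat

/-- An admissible threshold `β₁` exists, and for every admissible `β₁`, every `β ∈ (0, β₁)` and
every `1 < q < N / (N - β)` there is a constant `C = C(N, β, q)` such that for all nonnegative
`f ∈ L^q` the potential `ψ` converges a.e., the integral `S(t)ψ` converges everywhere, `S(t)ψ`
is positive everywhere if `f` is nontrivial, and the decay estimate holds. -/
theorem corollary3p1 (N : ℕ) (hN : 1 ≤ N) :
    (∃ β₁ : ℝ, BiharmonicHeat.IsPositivityThreshold N β₁) ∧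
    ∀ β₁ : ℝ, BiharmonicHeat.IsPositivityThreshold N β₁ →
    ∀ β ∈ Set.Ioo (0 : ℝ) β₁, ∀ q : ℝ, 1 < q → q < (N : ℝ) / ((N : ℝ) - β) →
    ∃ C : ℝ, 0 < C ∧
      ∀ f : EuclideanSpace ℝ (Fin N) → ℝ,
        MemLp f (ENNReal.ofReal q) volume → (∀ᵐ y, 0 ≤ f y) →
        (∀ᵐ x, Integrable (fun y => f y / ‖x - y‖ ^ β) volume) ∧
        (∀ (x : EuclideanSpace ℝ (Fin N)) (t : ℝ), 0 < t →
          Integrable (fun y => BiharmonicHeat.fundSol N (x - y) t *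
            BiharmonicHeat.rieszPotential N β f y) volume) ∧
        (¬ (∀ᵐ y, f y = 0) →
          ∀ (x : EuclideanSpace ℝ (Fin N)) (t : ℝ), 0 < t →
            0 < BiharmonicHeat.semigroup N t (BiharmonicHeat.rieszPotential N β f) x) ∧
        (∀ (x : EuclideanSpace ℝ (Fin N)) (t : ℝ), 0 < t →
          |BiharmonicHeat.semigroup N t (BiharmonicHeat.rieszPotential N β f) x| ≤
            C * t ^ (-((N : ℝ) / 4) * (1 / q + β / (N : ℝ) - 1)) *
              (eLpNorm f (ENNReal.ofReal q) volume).toReal) := by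
  have : NeZero N := ⟨by omega⟩
  refine ⟨exists_isPositivityThreshold N, fun β₁ hβ₁ β hβ q hq1 hqN => ?_⟩
  have hβN : β < N := hβ.2.trans hβ₁.1.2
  have h0 : 0 ≤ β := hβ.1.le
  have hqq := Real.HolderConjugate.conjExponent hq1
  set q' := q.conjExponent with hq'
  -- `q < N / (N - β)` says exactly that `β q' > N`, so that `S(1)|·|^(-β)` lies in `L^{q'}`.
  have hNq : (N : ℝ) < β * q' := by
    rw [lt_div_iff₀ (by linarith)] at hqN
    rw [hq', Real.conjExponent, ← mul_div_assoc, lt_div_iff₀ (by linarith)]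
    linarith
  -- The summand `1` only serves to make the constant positive.
  refine ⟨(∫ z : EuclideanSpace ℝ (Fin N), ‖powerEvolution N β 1 z‖ ^ q') ^ (1 / q') + 1,
    by positivity, fun f hf hf0 => ⟨ae_integrable_div_norm_rpow h0 hβN hqq hNq hf,
      fun x t ht => integrable_fundSol_mul_rieszPotential h0 hβN hqq hNq hf ht x,
      fun hne x t ht => semigroup_rieszPotential_pos h0 hβN hqq hNq hf hf0 hne ht
        (fun z => hβ₁.2.2 β hβ z t ht) x, fun x t ht => ?_⟩⟩
  refine (abs_semigroup_rieszPotential_le h0 hβN hqq hNq hf ht x).trans ?_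
  gcongr
  linarith
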